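/- **Setting.** Let $m,n\ge 1$. The Aztec rectangle graph $AR_{m,n}$ has as vertices the squares of a $(2m+1)\times(2n+1)$ chessboard whose colour is opposite to that of the corners, two of them being joined by an edge when they share a corner. The toroidal Aztec rectangle $T_{m,n}$ is obtained from $AR_{m,n}$ by identifying corresponding vertices along the top and bottom sides, and along the left and right sides (if $m=1$ or $n=1$ the resulting parallel edges are kept). It is bipartite; fix a proper colouring of its vertices with colours white and black. Write $\mathrm M(G)$ for the number of perfect matchings of $G$. **Windows.** For integers $0\le k<m$, $0\le l<n$, place a $(2k+1)\times(2l+1)$ chessboard (height $2k+1$, width $2l+1$) on the torus so that its corners are vertices of $T_{m,n}$; the vertices of $T_{m,n}$ on this board form a hole (window) of shape $O_{k,l}$. The hole is white-placed if the majority of its vertices are white, and black-placed otherwise. Its charge is the number of its white vertices minus the number of its black vertices. Its flank charge is $\mathrm f(O)=l$ if $O$ is white-placed and $\mathrm f(O)=-(l+1)$ if $O$ is black-placed. **Evolved forms.** A vertical separation at a vertex $v$ replaces $v$ by two vertices, one keeping the two edges of $v$ that go to the left and the other the two edges that go to the right; a horizontal separation replaces $v$ by two vertices, one keeping the two edges that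 go up and the other the two edges that go down. The evolved form $\mathrm e(O)$ of a hole $O$ of shape $O_{k,l}$ has the same centre as $O$, and is * if $O$ is white-placed: the hole of shape $O_{k+1,l-1}$ when $l\ge1$, and $k+1$ contiguous vertical separations (at the vertices of $O$) when $l=0$; * if $O$ is black-placed: the hole of shape $O_{k-1,l+1}$ when $k\ge1$, and $l+1$ contiguous horizontal separations (at the vertices of $O$) when $k=0$. The graph $T_{m,n}\setminus \mathrm e(O_1)\cup\cdots\cup\mathrm e(O_r)$ is obtained from $T_{m,n}$ by making all the separations and removing the vertices of all the evolved holes. If a separated vertex $v$ also belongs to an evolved hole (so that the two defects touch at $v$), the hole removes only those copies of $v$ that lie on its side of the separation, i.e. those for which the square next to $v$ on the side of the copy (left, right, above or below) belongs to the board of the hole. **Theorem 4.2.** Let $O_1,\dots,O_r$ be windows in $T_{m,n}$ whose chessboards are pairwise disjoint and whose total charge is zero, and assume that $T_{m,n}\setminus O_1\cup\cdots\cup O_r$ has at least one perfect matching. Then $$\mathrm M(T_{m,n}\setminus O_1\cup\cdots\cup O_r)=2^{\sum_{i=1}^r \mathrm f(O_i)}\,\mathrm M(T_{m,n}\setminus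 \mathrm e(O_1)\cup\cdots\cup \mathrm e(O_r)).$$ -/

import Mathlib

namespace ToroidalAztec

/-! ### Perfect matchings of multigraphs -/

/-- A perfect matching of a multigraph: a set of edges such that every vertex is an end of exactly
one of them. -/
def IsPerfectMatching {α β : Type*} (G : Graph α β) (M : Set β) : Prop :=
  M ⊆ G.edgeSet ∧ ∀ v ∈ G.vertexSet, ∃! e, e ∈ M ∧ G.Inc e v

/-- The number of perfect matchings of a multigraph. -/
noncomputable def numPerfectMatchings {α β : Type*} (G : Graph α β) : ℕ :=
  {M : Set β | IsPerfectMatching G M}.ncard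

/-! ### The toroidal Aztec rectangle -/

/-- Squares of the `(2m+1) × (2n+1)` chessboard after the top row of squares has been identified
with the bottom row, and the leftmost column with the rightmost one. The first coordinate is
horizontal, the second vertical; the corners of the chessboard become the square `(0, 0)`. -/
abbrev Square (m n : ℕ) := ZMod (2 * n) × ZMod (2 * m)

/-- The colour of a square of the chessboard (`0` for the colour of the corners). -/
def parity {m n : ℕ} (p : Square m n) : ZMod 2 :=
  ZMod.castHom (dvd_mul_right 2 n) (ZMod 2) p.1 + ZMod.castHom (dvd_mul_right 2 m) (ZMod 2) p.2

/-- The squares whose colour is opposite to that of the corners: the vertices of `T_{m,n}`. -/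
def IsVertex {m n : ℕ} (p : Square m n) : Prop := parity p = 1

/-- `1` (right, or up) for `true` and `-1` (left, or down) for `false`. -/
def sgn {k : ℕ} (b : Bool) : ZMod k := if b then 1 else -1

/-- The square sharing a corner with `p` in direction `(d.1, d.2)`. -/
def diag {m n : ℕ} (p : Square m n) (d : Bool × Bool) : Square m n :=
  (p.1 + sgn d.1, p.2 + sgn d.2)

/-- The toroidal Aztec rectangle graph `T_{m,n}`. Vertices are joined when their squares share a
corner. Every edge has a unique left end; the edge `(p, b)` is the one that has left end `p` and
goes up if `b = true` and down if `b = false`. (For `m, n ≥ 2` there are no parallel edges.) -/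
def torus (m n : ℕ) : Graph (Square m n) (Square m n × Bool) where
  vertexSet := {p | IsVertex p}
  IsLink e x y := IsVertex e.1 ∧
    ((x = e.1 ∧ y = diag e.1 (true, e.2)) ∨ (y = e.1 ∧ x = diag e.1 (true, e.2)))
  isLink_symm := by
    intro e _
    exact ⟨fun x y h => ⟨h.1, h.2.symm⟩⟩
  eq_or_eq_of_isLink_of_isLink := by
    rintro e x y v w ⟨_, ⟨h1, h2⟩ | ⟨h1, h2⟩⟩ ⟨_, ⟨h3, h4⟩ | ⟨h3, h4⟩⟩ <;>
      simp only [h1, h2, h3, h4, true_or, or_true]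
  left_mem_of_isLink := by
    rintro e x y ⟨h, ⟨rfl, _⟩ | ⟨_, rfl⟩⟩
    · exact h
    · have key : ∀ b : Bool, (if b then (1 : ZMod 2) else -1) = 1 := by decide
      have e1 : ∀ (k : ℕ) (b : Bool),
          ZMod.castHom (dvd_mul_right 2 k) (ZMod 2) (sgn b) = 1 := by
        intro k b
        rw [← key b]
        cases b <;> simp only [sgn, if_true, if_false, map_one, map_neg, Bool.false_eq_true]
      have h2 : (1 : ZMod 2) + 1 = 0 := by decide
      have h1 : parity e.1 = 1 := h
      change parity _ = 1
      unfold parity at h1 ⊢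
      simp only [diag, map_add, e1]
      rw [add_add_add_comm, h1, h2, add_zero]

/-- `W` is the set of white vertices in a proper colouring of `T_{m,n}` with colours white and
black. -/
def IsProperColouring {m n : ℕ} (W : Set (Square m n)) : Prop :=
  ∀ e x y, (torus m n).IsLink e x y → (x ∈ W ↔ y ∉ W)

/-! ### Holes in the shape of odd Aztec rectangles -/

/-- The `(2k+1) × (2l+1)` chessboard with centre `c`. -/
def board {m n : ℕ} (c : Square m n) (k l : ℕ) : Set (Square m n) :=
  {p | ∃ i j : ℤ, |i| ≤ l ∧ |j| ≤ k ∧ p = (c.1 + i, c.2 + j)}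

/-- The vertices of `T_{m,n}` on the `(2k+1) × (2l+1)` chessboard with centre `c`. If the corners
of this board are vertices, they form an odd Aztec rectangle of shape `O_{k,l}`. -/
def oddAztec {m n : ℕ} (c : Square m n) (k l : ℕ) : Set (Square m n) :=
  {p | p ∈ board c k l ∧ IsVertex p}

/-- A hole of `T_{m,n}` of shape `O_{k,l}`, where `k = height` and `l = width`, given by its
centre. The inequalities say that its chessboard embeds in the torus. -/
structure Window (m n : ℕ) where
  centre : Square m n
  height : ℕ
  width : ℕ
  height_lt : height < m
  width_lt : width < n
  isVertex_corner : IsVertex (m := m) (n := n) (centre.1 + width, centre.2 + height)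

namespace Window

variable {m n : ℕ}

/-- The chessboard of a window. -/
def squares (O : Window m n) : Set (Square m n) := board O.centre O.height O.width

/-- The vertices removed by a window. -/
def vertices (O : Window m n) : Set (Square m n) := oddAztec O.centre O.height O.width

/-- The charge: the number of white vertices minus the number of black ones. -/
noncomputable def charge (W : Set (Square m n)) (O : Window m n) : ℤ :=
  ((O.vertices ∩ W).ncard : ℤ) - ((O.vertices \ W).ncard : ℤ)

/-- A window is white-placed if the majority of its vertices are white; otherwise it is
black-placed. -/
def WhitePlaced (W : Set (Square m n)) (O : Window m n) : Prop :=
  (O.vertices \ W).ncard < (O.vertices ∩ W).ncard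

open Classical in
/-- The flank charge of a window of shape `O_{k,l}`: it is `l` if the window is white-placed, and
`-(l+1)` if it is black-placed. -/
noncomputable def flankCharge (W : Set (Square m n)) (O : Window m n) : ℤ :=
  if O.WhitePlaced W then (O.width : ℤ) else -((O.width : ℤ) + 1)

end Window

/-! ### Evolved forms -/

/-- The defects into which windows evolve. -/
inductive Defect (m n : ℕ)
  /-- the hole of shape `O_{k,l}` with centre `c` -/
  | hole (c : Square m n) (k l : ℕ)
  /-- `s` contiguous vertical separations, centred at `c` -/
  | verticalSeparations (c : Square m n) (s : ℕ)
  /-- `s` contiguous horizontal separations, centred at `c` -/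
  | horizontalSeparations (c : Square m n) (s : ℕ)

open Classical in
/-- The evolved form of a window. -/
noncomputable def Window.evolve {m n : ℕ} (W : Set (Square m n)) (O : Window m n) :
    Defect m n :=
  if O.WhitePlaced W then
    if 1 ≤ O.width then .hole O.centre (O.height + 1) (O.width - 1)
    else .verticalSeparations O.centre (O.height + 1)
  else
    if 1 ≤ O.height then .hole O.centre (O.height - 1) (O.width + 1)
    else .horizontalSeparations O.centre (O.width + 1)

namespace Defect

variable {m n : ℕ}

/-- The vertices at which a defect has a vertical separation: `s` consecutive vertices on the
vertical diagonal through the centre, symmetric about the centre. -/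
def verticalCuts : Defect m n → Set (Square m n)
  | verticalSeparations c s =>
      {p | ∃ i : ℕ, i < s ∧ p = (c.1, c.2 + (2 * (i : ZMod (2 * m)) - ((s : ZMod (2 * m)) - 1)))}
  | _ => ∅

/-- The vertices at which a defect has a horizontal separation: `s` consecutive vertices on the
horizontal diagonal through the centre, symmetric about the centre. -/
def horizontalCuts : Defect m n → Set (Square m n)
  | horizontalSeparations c s =>
      {p | ∃ i : ℕ, i < s ∧ p = (c.1 + (2 * (i : ZMod (2 * n)) - ((s : ZMod (2 * n)) - 1)), c.2)}
  | _ => ∅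

end Defect

/-- A vertex of a graph obtained from `T_{m,n}` by separations. An unseparated vertex `p` is
`(p, none, none)`; a vertical separation replaces it by its right and left copies
`(p, some true, none)` and `(p, some false, none)`, and a horizontal separation by its upper and
lower copies `(p, none, some true)` and `(p, none, some false)`. -/
abbrev Copy (m n : ℕ) := Square m n × Option Bool × Option Bool

open Classical in
/-- The copy of `p` to which the edge leaving `p` in direction `d` is attached after vertical
separations at the vertices in `CV` and horizontal separations at the vertices in `CH`. -/
noncomputable def copyAt {m n : ℕ} (CV CH : Set (Square m n)) (p : Square m n)
    (d : Bool × Bool) : Copy m n :=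
  (p, if p ∈ CV then some d.1 else none, if p ∈ CH then some d.2 else none)

/-- The graph obtained from `T_{m,n}` by making vertical separations at the vertices in `CV` and
horizontal separations at the vertices in `CH`. The edges are those of `T_{m,n}`: at a vertical
separation, the edges going left stay with the left copy and the edges going right with the right
copy, and similarly at a horizontal separation. -/
def separatedTorus {m n : ℕ} (CV CH : Set (Square m n)) :
    Graph (Copy m n) (Square m n × Bool) where
  vertexSet := {x | ∃ p d, IsVertex p ∧ x = copyAt CV CH p d}
  IsLink e x y := ∃ q, (torus m n).IsLink e e.1 q ∧ q = diag e.1 (true, e.2) ∧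
    ((x = copyAt CV CH e.1 (true, e.2) ∧ y = copyAt CV CH q (false, !e.2)) ∨
      (y = copyAt CV CH e.1 (true, e.2) ∧ x = copyAt CV CH q (false, !e.2)))
  isLink_symm := by
    intro e _
    exact ⟨fun x y ⟨q, h, hq, h'⟩ => ⟨q, h, hq, h'.symm⟩⟩
  eq_or_eq_of_isLink_of_isLink := by
    rintro e x y v w ⟨q, _, rfl, ⟨h1, h2⟩ | ⟨h1, h2⟩⟩ ⟨q', _, rfl, ⟨h3, h4⟩ | ⟨h3, h4⟩⟩ <;>
      simp only [h1, h2, h3, h4, true_or, or_true]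
  left_mem_of_isLink := by
    rintro e x y ⟨q, h, _, ⟨rfl, _⟩ | ⟨_, rfl⟩⟩
    · exact ⟨_, _, h.left_mem, rfl⟩
    · exact ⟨_, _, h.right_mem, rfl⟩

/-- The vertices removed by a defect. A hole removes the vertices of its odd Aztec rectangle. If
such a vertex `p` has been separated into two copies by another defect (then `p` is on the boundary
of the hole, where the two defects touch), the hole removes only the copies of `p` that are on its
own side of the separation, that is, those for which the square next to `p` on the side of the copy
belongs to the chessboard of the hole. -/
def Defect.removed {m n : ℕ} : Defect m n → Set (Copy m n)
  | .hole c k l => {x | x.1 ∈ oddAztec c k l ∧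
      (∀ b, x.2.1 = some b → (x.1.1 + sgn b, x.1.2) ∈ board c k l) ∧
      (∀ b, x.2.2 = some b → (x.1.1, x.1.2 + sgn b) ∈ board c k l)}
  | _ => ∅

/-- The graph obtained from `T_{m,n}` by making the given defects in it. -/
def torusWithDefects {m n r : ℕ} (D : Fin r → Defect m n) :
    Graph (Copy m n) (Square m n × Bool) :=
  (separatedTorus (⋃ i, (D i).verticalCuts) (⋃ i, (D i).horizontalCuts)).deleteVerts
    (⋃ i, (D i).removed)

/-- The graph obtained from `T_{m,n}` by removing the vertices of the given windows. -/
def torusWithWindows {m n r : ℕ} (O : Fin r → Window m n) :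
    Graph (Square m n) (Square m n × Bool) :=
  (torus m n).deleteVerts (⋃ i, (O i).vertices)

end ToroidalAztec

namespace ToroidalAztec

open Finset

/-! ### Perfect matchings of graphs decomposed into four-cycles -/

/-! The proof is a complementation argument on four-cycles. Cut the torus into the four-cycles, or
cells, around the squares both of whose coordinates have parity η, with η chosen so that the white
vertices are the left and right ends of cells and the black ones the upper and lower ends
(`IsProperColouring.exists_parity`). Every edge lies in one cell and every vertex consists of two
halves, one for each cell that it serves. A perfect matching therefore amounts to choosing which
half of each vertex is covered, and then matching the covered part of each cell
(`IsGluing.numPerfectMatchings_eq`). Reversing all the choices complements the covered part of every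
cell, and a part with b black vertices weighs 2^(b-1) times its complement (`two_mul_cellWeight`).
The total factor thus depends only on the numbers of cells and of black vertices.

With windows present, a cell centred in a window has lost both ends of one colour, so by balance
nothing is covered in it. These cells stay empty and only the others are complemented. A remaining
vertex on one empty cell then becomes uncovered, hence removed. A deleted vertex on exactly one
empty cell becomes covered once, hence reappears. A deleted vertex between two empty cells stays
deleted, and one that touches no empty cell becomes covered in both halves, hence separated. These
changes are exactly the evolved forms (`Window.localEvolution`,
`LocalEvolution.complementaryDefects`). `ComplementaryDefects.sum_prod_cellWeight` turns them into
the identity of weighted counts. A remaining vertex between two empty cells could not be covered at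
all, and the assumed perfect matching excludes it.

The exponent is (remaining black vertices) - (cells) + (empty cells). There are as many cells as
black vertices in the whole torus, so this is the sum over the windows of (cells inside) - (black
vertices inside), which is the flank charge (`Window.flankCharge_eq`, `sum_flankCharge`). -/

/-- The side of the cell on which the end of kind `k` of the edge `d` lies. -/
def cellEnd (d : Bool × Bool) (k : Bool) : Bool := if k then d.1 else d.2

/-- The perfect matchings of the subgraph of a four-cycle spanned by the vertices in `t`. -/
def cellMatchings (t : Bool → Bool → Bool) : Finset (Finset (Bool × Bool)) :=
  univ.filter fun m => ∀ k x, (m.filter fun d => cellEnd d k = x).card = (t k x).toNat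

/-- The number of perfect matchings of the subgraph of a four-cycle spanned by `t`. -/
def cellWeight (t : Bool → Bool → Bool) : ℕ := (cellMatchings t).card

/-- The number of vertices of the second colour class in `t`. -/
def cellCount (t : Bool → Bool → Bool) : ℕ := (t false false).toNat + (t false true).toNat

lemma bool_fun_eq (t : Bool → Bool → Bool) :
    t = fun k x => if k then (if x then t true true else t true false)
      else (if x then t false true else t false false) := by
  funext k x
  cases k <;> cases x <;> rfl

/-- A four-cycle is the complete bipartite graph on two and two vertices, so only the sizes of the
two classes matter. -/
lemma cellWeight_table : ∀ a b c d : Bool,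
    cellWeight (fun k x => if k then (if x then a else b) else (if x then c else d)) =
      if a.toNat + b.toNat = c.toNat + d.toNat then (if a && b then 2 else 1) else 0 := by
  decide +revert

lemma cellWeight_eq (t : Bool → Bool → Bool) : cellWeight t =
    if (t true true).toNat + (t true false).toNat = (t false true).toNat + (t false false).toNat
    then (if t true true && t true false then 2 else 1) else 0 := by
  rw [← cellWeight_table, ← bool_fun_eq]

/-- An unbalanced set has an unbalanced complement, so both sides vanish. Balanced sets with 0, 1, 2
vertices in each class weigh 1, 1, 2, and their complements weigh 2, 1, 1. -/
lemma two_mul_cellWeight (t : Bool → Bool → Bool) :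
    (cellWeight t : ℚ) = 2 ^ ((cellCount t : ℤ) - 1) * cellWeight (fun k x => !(t k x)) := by
  rw [cellWeight_eq, cellWeight_eq, cellCount]
  cases t true true <;> cases t true false <;> cases t false true <;> cases t false false <;>
    norm_num

lemma cellWeight_not_ne_zero {t : Bool → Bool → Bool} (h : cellWeight t ≠ 0) :
    cellWeight (fun k x => !(t k x)) ≠ 0 := by
  intro h0
  have := two_mul_cellWeight t
  rw [h0] at this
  simp only [Nat.cast_zero, mul_zero, Nat.cast_eq_zero] at this
  exact h this

lemma cellWeight_false : cellWeight (fun _ _ => false) = 1 := by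
  rw [cellWeight_eq]; rfl

/-- Balance of the two classes: if one is absent, so is the other. This is what empties the cells
inside a window. -/
lemma eq_false_of_cellWeight_ne_zero {t : Bool → Bool → Bool} (h : cellWeight t ≠ 0) {k : Bool}
    (hk : ∀ x, t k x = false) (k' x' : Bool) : t k' x' = false := by
  rw [cellWeight_eq] at h
  have h1 := hk true
  have h2 := hk false
  cases k <;> cases k' <;> cases x' <;> revert h1 h2 h <;>
    cases t true true <;> cases t true false <;> cases t false true <;> cases t false false <;>
    simp

section Decomposition

variable {α E C : Type*}

/-- A state `s`, telling for each half vertex whether it is covered inside its cell, is admissible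
if deleted vertices are not covered and every other vertex is covered exactly once. -/
def Admissible (κ : C × Bool × Bool → α) (R : Set α) (s : C → Bool → Bool → Bool) : Prop :=
  ∀ h, (κ h ∈ R → s h.1 h.2.1 h.2.2 = false) ∧
    (κ h ∉ R → ∃! h', κ h' = κ h ∧ s h'.1 h'.2.1 h'.2.2 = true)

/-- `G` is obtained by gluing four-cycles indexed by `C` along `κ` and deleting the vertices
in `R`. -/
structure IsGluing (G : Graph α E) (φ : C × Bool × Bool → E) (κ : C × Bool × Bool → α)
    (R : Set α) : Prop where
  inj : Function.Injective φ
  link : ∀ e x y, G.IsLink e x y ↔ ∃ c d, φ (c, d) = e ∧ κ (c, true, d.1) ∉ R ∧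
    κ (c, false, d.2) ∉ R ∧ ((x = κ (c, true, d.1) ∧ y = κ (c, false, d.2)) ∨
      (y = κ (c, true, d.1) ∧ x = κ (c, false, d.2)))
  vert : ∀ v, v ∈ G.vertexSet ↔ v ∉ R ∧ ∃ h, κ h = v
  ne : ∀ c c' x x', κ (c, true, x) ≠ κ (c', false, x')

/-- The half vertices covered by a set of edges. -/
noncomputable def coverState (f : C → Finset (Bool × Bool)) (c : C) (k x : Bool) : Bool :=
  decide (∃ d ∈ f c, cellEnd d k = x)

lemma coverState_eq_true {f : C → Finset (Bool × Bool)} {c : C} {k x : Bool} :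
    coverState f c k x = true ↔ ∃ d ∈ f c, cellEnd d k = x := by
  simp [coverState]

lemma coverState_of_mem {f : C → Finset (Bool × Bool)} {c : C} {d : Bool × Bool} (h : d ∈ f c)
    (k : Bool) : coverState f c k (cellEnd d k) = true :=
  coverState_eq_true.2 ⟨d, h, rfl⟩

/-- A set of edges covers what it covers, so being a perfect matching of that part only requires the
edges to be disjoint. -/
lemma mem_cellMatchings_coverState {f : C → Finset (Bool × Bool)} {c : C} :
    f c ∈ cellMatchings (coverState f c) ↔
      ∀ d ∈ f c, ∀ d' ∈ f c, ∀ k, cellEnd d k = cellEnd d' k → d = d' := by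
  simp only [cellMatchings, mem_filter, mem_univ, true_and]
  constructor
  · intro h d hd d' hd' k hk
    have h1 := h k (cellEnd d k)
    rw [coverState_of_mem hd, Bool.toNat_true] at h1
    exact card_le_one.1 h1.le d (by simp [hd]) d' (by simp [hd', hk])
  · intro h k x
    by_cases hx : ∃ d ∈ f c, cellEnd d k = x
    · rw [coverState_eq_true.2 hx, Bool.toNat_true]
      obtain ⟨d, hd, hdx⟩ := hx
      refine card_eq_one.2 ⟨d, ?_⟩
      ext d'
      simp only [mem_filter, mem_singleton]
      constructor
      · rintro ⟨h1, h2⟩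
        exact h _ h1 _ hd k (h2.trans hdx.symm)
      · rintro rfl
        exact ⟨hd, hdx⟩
    · have h0 : coverState f c k x = false := by
        rw [← Bool.not_eq_true, coverState_eq_true]; exact hx
      rw [h0, Bool.toNat_false, card_eq_zero, filter_eq_empty_iff]
      intro d hd hdx
      exact hx ⟨d, hd, hdx⟩

lemma coverState_eq_of_mem {f : C → Finset (Bool × Bool)} {c : C} {t : Bool → Bool → Bool}
    (h : f c ∈ cellMatchings t) : coverState f c = t := by
  simp only [cellMatchings, mem_filter, mem_univ, true_and] at h
  funext k x
  have h1 := h k x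
  rw [Bool.eq_iff_iff, coverState_eq_true]
  constructor
  · rintro ⟨d, hd, hdx⟩
    by_contra h0
    rw [Bool.not_eq_true] at h0
    rw [h0, Bool.toNat_false, card_eq_zero, filter_eq_empty_iff] at h1
    exact h1 hd hdx
  · intro h0
    rw [h0, Bool.toNat_true] at h1
    obtain ⟨d, hd⟩ := card_pos.1 (h1.symm ▸ Nat.one_pos)
    exact ⟨d, (mem_filter.1 hd).1, (mem_filter.1 hd).2⟩

namespace IsGluing

variable {G : Graph α E} {φ : C × Bool × Bool → E} {κ : C × Bool × Bool → α} {R : Set α}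

lemma mem_edgeSet (hG : IsGluing G φ κ R) (c : C) (d : Bool × Bool) :
    φ (c, d) ∈ G.edgeSet ↔ ∀ k, κ (c, k, cellEnd d k) ∉ R := by
  rw [Graph.edge_mem_iff_exists_isLink]
  simp only [hG.link]
  constructor
  · rintro ⟨x, y, c', d', h, h1, h2, _⟩ k
    obtain ⟨rfl, rfl⟩ := Prod.mk.inj (hG.inj h)
    cases k
    · exact h2
    · exact h1
  · intro h
    exact ⟨_, _, c, d, rfl, h true, h false, Or.inl ⟨rfl, rfl⟩⟩

lemma exists_of_mem_edgeSet (hG : IsGluing G φ κ R) {e : E} (he : e ∈ G.edgeSet) :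
    ∃ c d, φ (c, d) = e := by
  rw [Graph.edge_mem_iff_exists_isLink] at he
  simp only [hG.link] at he
  obtain ⟨x, y, c', d', h, _⟩ := he
  exact ⟨c', d', h⟩

lemma inc_iff (hG : IsGluing G φ κ R) (c : C) (d : Bool × Bool) (v : α) :
    G.Inc (φ (c, d)) v ↔ (∀ k, κ (c, k, cellEnd d k) ∉ R) ∧ ∃ k, κ (c, k, cellEnd d k) = v := by
  simp only [Graph.Inc, hG.link]
  constructor
  · rintro ⟨y, c', d', h, h1, h2, h3⟩
    obtain ⟨rfl, rfl⟩ := Prod.mk.inj (hG.inj h)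
    refine ⟨fun k => ?_, ?_⟩
    · cases k
      · exact h2
      · exact h1
    · rcases h3 with ⟨h, _⟩ | ⟨_, h⟩
      · exact ⟨true, h.symm⟩
      · exact ⟨false, h.symm⟩
  · rintro ⟨h, k, hk⟩
    cases k
    · exact ⟨_, c, d, rfl, h true, h false, Or.inr ⟨rfl, hk.symm⟩⟩
    · exact ⟨_, c, d, rfl, h true, h false, Or.inl ⟨hk.symm, rfl⟩⟩

/-- The set of edges of `G` given by its intersections with the cells. -/
def edges (φ : C × Bool × Bool → E) (f : C → Finset (Bool × Bool)) : Set E :=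
  {e | ∃ c, ∃ d ∈ f c, φ (c, d) = e}

lemma mem_edges (hG : IsGluing G φ κ R) {f : C → Finset (Bool × Bool)} {c : C} {d : Bool × Bool} :
    φ (c, d) ∈ edges φ f ↔ d ∈ f c := by
  constructor
  · rintro ⟨c', d', h, h'⟩
    obtain ⟨rfl, rfl⟩ := Prod.mk.inj (hG.inj h')
    exact h
  · intro h
    exact ⟨c, d, h, rfl⟩

lemma edges_injective (hG : IsGluing G φ κ R) : Function.Injective (edges φ) := by
  intro f g h
  funext c
  ext d
  rw [← hG.mem_edges, h, hG.mem_edges]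

/-- Two edges meeting at a vertex either lie in the same cell, which is a condition on that cell, or
in different cells, which is a condition on the cover state alone. -/
lemma isPerfectMatching_edges (hG : IsGluing G φ κ R) (f : C → Finset (Bool × Bool)) :
    IsPerfectMatching G (edges φ f) ↔
      Admissible κ R (coverState f) ∧ ∀ c, f c ∈ cellMatchings (coverState f c) := by
  simp only [mem_cellMatchings_coverState]
  constructor
  · rintro ⟨hsub, hpm⟩
    have havoid : ∀ c, ∀ d ∈ f c, ∀ k, κ (c, k, cellEnd d k) ∉ R := fun c d hd =>
      (hG.mem_edgeSet c d).1 (hsub ⟨c, d, hd, rfl⟩)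
    have huniq : ∀ c, ∀ d ∈ f c, ∀ k, ∀ c', ∀ d' ∈ f c', ∀ k',
        κ (c, k, cellEnd d k) = κ (c', k', cellEnd d' k') → c = c' ∧ d = d' := by
      intro c d hd k c' d' hd' k' h
      obtain ⟨e, -, he⟩ := hpm _ ((hG.vert (κ (c, k, cellEnd d k))).2
        ⟨havoid c d hd k, _, rfl⟩)
      have h1 := he (φ (c, d)) ⟨hG.mem_edges.2 hd, (hG.inc_iff _ _ _).2 ⟨havoid c d hd, k, rfl⟩⟩
      have h2 := he (φ (c', d')) ⟨hG.mem_edges.2 hd',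
        (hG.inc_iff _ _ _).2 ⟨havoid c' d' hd', k', h.symm⟩⟩
      exact Prod.mk.inj (hG.inj (h1.trans h2.symm))
    refine ⟨?_, ?_⟩
    · rintro ⟨c, k, x⟩
      refine ⟨fun h => ?_, fun h => ?_⟩
      · rw [← Bool.not_eq_true, coverState_eq_true]
        dsimp only
        rintro ⟨d, hd, rfl⟩
        exact havoid c d hd k h
      · obtain ⟨e, ⟨⟨c', d', hd', rfl⟩, he2⟩, -⟩ :=
          hpm _ ((hG.vert (κ (c, k, x))).2 ⟨h, _, rfl⟩)
        obtain ⟨-, k', hk'⟩ := (hG.inc_iff _ _ _).1 he2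
        refine ⟨(c', k', cellEnd d' k'), ⟨hk', coverState_of_mem hd' k'⟩, ?_⟩
        rintro ⟨c₂, k₂, x₂⟩ ⟨h1, h2⟩
        dsimp only at h2
        obtain ⟨d₂, hd₂, rfl⟩ := coverState_eq_true.1 h2
        obtain ⟨rfl, rfl⟩ := huniq c₂ d₂ hd₂ k₂ c' d' hd' k' (h1.trans hk'.symm)
        -- The same edge could serve the vertex with its other end only if both ends coincided,
        -- which `hG.ne` forbids.
        have hkk : k₂ = k' := by
          have h3 := h1.trans hk'.symm
          cases k₂ <;> cases k' <;> try rfl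
          · exact absurd h3.symm (hG.ne _ _ _ _)
          · exact absurd h3 (hG.ne _ _ _ _)
        rw [hkk]
    · intro c d hd d' hd' k h
      exact (huniq c d hd k c d' hd' k (by rw [h])).2
  · rintro ⟨hadm, hloc⟩
    have havoid : ∀ c, ∀ d ∈ f c, ∀ k, κ (c, k, cellEnd d k) ∉ R := by
      intro c d hd k h
      have := (hadm _).1 h
      simp only [coverState_of_mem hd, Bool.true_eq_false] at this
    refine ⟨?_, ?_⟩
    · rintro _ ⟨c, d, hd, rfl⟩
      exact (hG.mem_edgeSet c d).2 (havoid c d hd)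
    · intro v hv
      obtain ⟨hvR, h, rfl⟩ := (hG.vert v).1 hv
      obtain ⟨⟨c, k, x⟩, ⟨h1, h2⟩, h3⟩ := (hadm h).2 hvR
      dsimp only at h2
      obtain ⟨d, hd, rfl⟩ := coverState_eq_true.1 h2
      refine ⟨φ (c, d), ⟨hG.mem_edges.2 hd, (hG.inc_iff _ _ _).2 ⟨havoid c d hd, k, h1⟩⟩, ?_⟩
      rintro _ ⟨⟨c', d', hd', rfl⟩, hinc⟩
      obtain ⟨-, k', hk'⟩ := (hG.inc_iff _ _ _).1 hinc
      have := h3 (c', k', cellEnd d' k') ⟨hk', coverState_of_mem hd' k'⟩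
      simp only [Prod.mk.injEq] at this
      obtain ⟨rfl, rfl, h4⟩ := this
      rw [hloc c' d' hd' d hd k' h4]

open Classical in
/-- The perfect matchings of a graph glued from four-cycles, counted according to the sets of
vertices covered inside the cells. -/
lemma numPerfectMatchings_eq [Fintype C] (hG : IsGluing G φ κ R) :
    numPerfectMatchings G =
      ∑ s ∈ univ.filter (fun s : C → Bool → Bool → Bool => Admissible κ R s),
        ∏ c, cellWeight (s c) := by
  have h1 : {M : Set E | IsPerfectMatching G M} =
      edges φ '' {f | IsPerfectMatching G (edges φ f)} := by
    ext M
    simp only [Set.mem_ofPred_eq, Set.mem_image]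
    constructor
    · intro hM
      have hM' : edges φ (fun c => univ.filter fun d => φ (c, d) ∈ M) = M := by
        ext e
        constructor
        · rintro ⟨c, d, hd, rfl⟩
          exact (mem_filter.1 hd).2
        · intro he
          obtain ⟨c, d, rfl⟩ := hG.exists_of_mem_edgeSet (hM.1 he)
          exact ⟨c, d, by simpa using he, rfl⟩
      exact ⟨_, hM'.symm ▸ hM, hM'⟩
    · rintro ⟨f, hf, rfl⟩
      exact hf
  rw [numPerfectMatchings, h1, Set.ncard_image_of_injective _ hG.edges_injective,
    Set.ncard_eq_toFinset_card']
  -- The fibre of `coverState` over an admissible state is a product, since the cells can be matched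
  -- independently.
  rw [card_eq_sum_card_fiberwise (f := coverState) (t := univ.filter fun s => Admissible κ R s)]
  · refine sum_congr rfl fun s hs => ?_
    simp only [cellWeight]
    rw [← Fintype.card_piFinset]
    congr 1
    ext f
    simp only [mem_filter, Set.mem_toFinset, Set.mem_ofPred_eq, Fintype.mem_piFinset,
      hG.isPerfectMatching_edges]
    constructor
    · rintro ⟨⟨_, h⟩, rfl⟩
      exact h
    · intro h
      have h2 : coverState f = s := funext fun c => coverState_eq_of_mem (h c)
      rw [h2]
      exact ⟨⟨(mem_filter.1 hs).2, h⟩, rfl⟩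
  · intro f hf
    simp only [Set.coe_toFinset, Set.mem_ofPred_eq, hG.isPerfectMatching_edges] at hf
    simpa using hf.1

end IsGluing

end Decomposition

lemma prod_zpow_eq {ι : Type*} (s : Finset ι) (f : ι → ℤ) {a : ℚ} (ha : a ≠ 0) :
    ∏ i ∈ s, a ^ f i = a ^ ∑ i ∈ s, f i := by
  classical
  induction s using Finset.induction_on with
  | empty => simp
  | insert i s hi ih => rw [prod_insert hi, sum_insert hi, ih, zpow_add₀ ha]

/-! ### Complementing states outside the empty cells. -/

section Complement

variable {α C : Type*}

/-- The admissible states, when every vertex outside `cut` consists of two halves exchanged by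
`opp`, those in `cut` are separated into their halves, and those in `R` are deleted. -/
def ValidState (opp : C × Bool × Bool → C × Bool × Bool) (R cut : Set (C × Bool × Bool))
    (s : C → Bool → Bool → Bool) : Prop :=
  ∀ h, (h ∈ R → s h.1 h.2.1 h.2.2 = false) ∧
    (h ∉ R → (h ∈ cut → s h.1 h.2.1 h.2.2 = true) ∧
      (h ∉ cut → s h.1 h.2.1 h.2.2 = !(s (opp h).1 (opp h).2.1 (opp h).2.2)))

/-- Among two halves exactly one is covered, so their states are negations of each other; a half
that forms a vertex by itself must be covered. -/
lemma admissible_iff_validState {opp : C × Bool × Bool → C × Bool × Bool}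
    (hopp : ∀ h, opp h ≠ h) {κ : C × Bool × Bool → α} {R : Set α} {cut : Set (C × Bool × Bool)}
    (hκ : ∀ h h', κ h' = κ h ↔ h' = h ∨ (h' = opp h ∧ h ∉ cut)) (s : C → Bool → Bool → Bool) :
    Admissible κ R s ↔ ValidState opp (κ ⁻¹' R) cut s := by
  refine forall_congr' fun h => and_congr Iff.rfl (imp_congr Iff.rfl ?_)
  simp only [hκ]
  by_cases hc : h ∈ cut
  · simp only [hc, not_true_eq_false, and_false, or_false, forall_const, false_implies, and_true]
    constructor
    · rintro ⟨h', ⟨rfl, h1⟩, _⟩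
      exact h1
    · intro h1
      exact ⟨h, ⟨rfl, h1⟩, fun y hy => hy.1⟩
  · simp only [hc, not_false_eq_true, and_true, false_implies, forall_const, true_and]
    constructor
    · rintro ⟨h', ⟨rfl | rfl, h1⟩, h2⟩
      · rw [h1]
        by_contra h3
        have h4 : s (opp h').1 (opp h').2.1 (opp h').2.2 = true := by
          revert h3; cases s (opp h').1 (opp h').2.1 (opp h').2.2 <;> simp
        exact hopp _ (h2 _ ⟨Or.inr rfl, h4⟩)
      · rw [h1]
        by_contra h3
        have h4 : s h.1 h.2.1 h.2.2 = true := by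
          revert h3; cases s h.1 h.2.1 h.2.2 <;> simp
        exact hopp _ (h2 _ ⟨Or.inl rfl, h4⟩).symm
    · intro h1
      cases h2 : s h.1 h.2.1 h.2.2
      · rw [h2] at h1
        refine ⟨opp h, ⟨Or.inr rfl, by simpa using h1.symm⟩, ?_⟩
        rintro y ⟨rfl | rfl, h3⟩
        · rw [h2] at h3; exact absurd h3 (by decide)
        · rfl
      · rw [h2] at h1
        refine ⟨h, ⟨Or.inl rfl, h2⟩, ?_⟩
        rintro y ⟨rfl | rfl, h3⟩
        · rfl
        · rw [h3] at h1; exact absurd h1 (by decide)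

/-- The conditions under which deleting `R` after separating the vertices in `cut` is the
complement, outside the cells in `F`, of deleting `H`. -/
structure ComplementaryDefects (opp : C × Bool × Bool → C × Bool × Bool)
    (H R cut : Set (C × Bool × Bool)) (F : Set C) : Prop where
  opp_opp : ∀ h, opp (opp h) = h
  opp_mem_H : ∀ h, h ∈ H → opp h ∈ H
  opp_mem_R : ∀ h, h ∉ cut → h ∈ R → opp h ∈ R
  cut_subset : cut ⊆ H
  deleted_of_mem : ∀ c ∈ F, ∃ k, ∀ x, (c, k, x) ∈ H
  removed_of_mem : ∀ c ∈ F, ∃ k, ∀ x, (c, k, x) ∈ R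
  mem_of_removed : ∀ h ∈ R, h.1 ∈ F ∨ (h ∉ H ∧ (opp h).1 ∈ F)
  removed_of_cut : ∀ h ∈ cut, h.1 ∈ F → h ∈ R
  removed_of_not_deleted : ∀ h ∉ H, h.1 ∈ F → h ∈ R
  removed_of_mem_mem : ∀ h ∈ H, h ∉ cut → h.1 ∈ F → (opp h).1 ∈ F → h ∈ R
  mem_or_mem : ∀ h ∈ H, h ∉ cut → h.1 ∈ F ∨ (opp h).1 ∈ F

open Classical in
/-- The state complementary to `s` outside the cells in `F`, where it is empty. -/
noncomputable def complState (F : Set C) (s : C → Bool → Bool → Bool) (c : C) (k x : Bool) :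
    Bool :=
  if c ∈ F then false else !(s c k x)

namespace ComplementaryDefects

variable {opp : C × Bool × Bool → C × Bool × Bool} {H R cut : Set (C × Bool × Bool)} {F : Set C}

lemma complState_of_mem {s : C → Bool → Bool → Bool} {c : C} (h : c ∈ F) (k x : Bool) :
    complState F s c k x = false := by
  simp [complState, h]

lemma complState_of_notMem {s : C → Bool → Bool → Bool} {c : C} (h : c ∉ F) (k x : Bool) :
    complState F s c k x = !(s c k x) := by
  simp [complState, h]

lemma complState_complState {s : C → Bool → Bool → Bool}
    (hs : ∀ c ∈ F, ∀ k x, s c k x = false) : complState F (complState F s) = s := by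
  funext c k x
  by_cases h : c ∈ F
  · rw [complState_of_mem h, hs c h]
  · rw [complState_of_notMem h, complState_of_notMem h, Bool.not_not]

lemma eq_false_of_validState (hD : ComplementaryDefects opp H R cut F)
    {s : C → Bool → Bool → Bool} (hs : ValidState opp H ∅ s) (hw : ∀ c, cellWeight (s c) ≠ 0) :
    ∀ c ∈ F, ∀ k x, s c k x = false := by
  intro c hc k x
  obtain ⟨k', hk'⟩ := hD.deleted_of_mem c hc
  exact eq_false_of_cellWeight_ne_zero (hw c) (fun x => (hs _).1 (hk' x)) k x

lemma eq_false_of_validState' (hD : ComplementaryDefects opp H R cut F)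
    {s : C → Bool → Bool → Bool} (hs : ValidState opp R cut s) (hw : ∀ c, cellWeight (s c) ≠ 0) :
    ∀ c ∈ F, ∀ k x, s c k x = false := by
  intro c hc k x
  obtain ⟨k', hk'⟩ := hD.removed_of_mem c hc
  exact eq_false_of_cellWeight_ne_zero (hw c) (fun x => (hs _).1 (hk' x)) k x

lemma cellWeight_complState {s : C → Bool → Bool → Bool} (hw : ∀ c, cellWeight (s c) ≠ 0) (c : C) :
    cellWeight (complState F s c) ≠ 0 := by
  by_cases h : c ∈ F
  · have : complState F s c = fun _ _ => false := by
      funext k x; exact complState_of_mem h k x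
    rw [this, cellWeight_false]; exact one_ne_zero
  · have : complState F s c = fun k x => !(s c k x) := by
      funext k x; exact complState_of_notMem h k x
    rw [this]; exact cellWeight_not_ne_zero (hw c)

/-- A remaining vertex between two empty cells is covered by neither half. Hence a single state of
nonzero weight rules out such vertices. -/
lemma not_mem_and_mem (hD : ComplementaryDefects opp H R cut F)
    {s : C → Bool → Bool → Bool} (hs : ValidState opp H ∅ s) (hw : ∀ c, cellWeight (s c) ≠ 0)
    {h : C × Bool × Bool} (hh : h ∉ H) (h1 : h.1 ∈ F) : (opp h).1 ∉ F := by
  intro h2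
  have h3 := ((hs h).2 hh).2 (Set.notMem_empty _)
  rw [hD.eq_false_of_validState hs hw _ h1, hD.eq_false_of_validState hs hw _ h2] at h3
  exact absurd h3 (by decide)

lemma validState_complState (hD : ComplementaryDefects opp H R cut F)
    {s : C → Bool → Bool → Bool} (hs : ValidState opp H ∅ s) (hw : ∀ c, cellWeight (s c) ≠ 0) :
    ValidState opp R cut (complState F s) := by
  have hF := hD.eq_false_of_validState hs hw
  intro h
  refine ⟨fun hR => ?_, fun hR => ⟨fun hc => ?_, fun hc => ?_⟩⟩
  · by_cases h1 : h.1 ∈ F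
    · exact complState_of_mem h1 _ _
    · obtain ⟨h2, h3⟩ := (hD.mem_of_removed h hR).resolve_left h1
      rw [complState_of_notMem h1, ((hs h).2 h2).2 (Set.notMem_empty _), hF _ h3]
      rfl
  · have h1 : h.1 ∉ F := fun h1 => hR (hD.removed_of_cut h hc h1)
    rw [complState_of_notMem h1, (hs h).1 (hD.cut_subset hc)]
    rfl
  · by_cases hH : h ∈ H
    · by_cases h1 : h.1 ∈ F
      · have h2 : (opp h).1 ∉ F := fun h2 => hR (hD.removed_of_mem_mem h hH hc h1 h2)
        rw [complState_of_mem h1, complState_of_notMem h2, (hs _).1 (hD.opp_mem_H h hH)]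
        rfl
      · have h2 := (hD.mem_or_mem h hH hc).resolve_left h1
        rw [complState_of_mem h2, complState_of_notMem h1, (hs _).1 hH]
    · have h1 : h.1 ∉ F := fun h1 => hR (hD.removed_of_not_deleted h hH h1)
      have h2 : (opp h).1 ∉ F := by
        intro h2
        have h3 : opp h ∉ H := fun h3 => hH (hD.opp_opp h ▸ hD.opp_mem_H _ h3)
        have h4 : opp h ∉ cut := fun h4 => h3 (hD.cut_subset h4)
        exact hR (hD.opp_opp h ▸ hD.opp_mem_R _ h4 (hD.removed_of_not_deleted _ h3 h2))
      rw [complState_of_notMem h1, complState_of_notMem h2, ((hs h).2 hH).2 (Set.notMem_empty _)]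

/-- The exclusion of remaining vertices between two empty cells enters as `hex`: states of the
evolved graph do not give it, because such vertices are removed there. -/
lemma validState_complState' (hD : ComplementaryDefects opp H R cut F)
    (hex : ∀ h ∉ H, h.1 ∈ F → (opp h).1 ∉ F)
    {s : C → Bool → Bool → Bool} (hs : ValidState opp R cut s) (hw : ∀ c, cellWeight (s c) ≠ 0) :
    ValidState opp H ∅ (complState F s) := by
  have hF := hD.eq_false_of_validState' hs hw
  intro h
  refine ⟨fun hH => ?_, fun hH => ⟨fun hc => absurd hc (Set.notMem_empty _), fun _ => ?_⟩⟩
  · by_cases h1 : h.1 ∈ F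
    · exact complState_of_mem h1 _ _
    · have hR : h ∉ R := fun hR => (hD.mem_of_removed h hR).elim h1 fun h2 => h2.1 hH
      rw [complState_of_notMem h1]
      by_cases hc : h ∈ cut
      · rw [((hs h).2 hR).1 hc]; rfl
      · rw [((hs h).2 hR).2 hc, hF _ ((hD.mem_or_mem h hH hc).resolve_left h1)]; rfl
  · have hc : h ∉ cut := fun hc => hH (hD.cut_subset hc)
    have hH' : opp h ∉ H := fun h3 => hH (hD.opp_opp h ▸ hD.opp_mem_H _ h3)
    have hc' : opp h ∉ cut := fun hc => hH' (hD.cut_subset hc)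
    by_cases h1 : h.1 ∈ F
    · have h2 := hex h hH h1
      rw [complState_of_mem h1, complState_of_notMem h2,
        (hs (opp h)).1 (hD.opp_mem_R h hc (hD.removed_of_not_deleted h hH h1))]
      rfl
    · by_cases h2 : (opp h).1 ∈ F
      · have hR := hD.opp_mem_R _ hc' (hD.removed_of_not_deleted _ hH' h2)
        rw [hD.opp_opp] at hR
        rw [complState_of_mem h2, complState_of_notMem h1, (hs h).1 hR]
      · have hR : h ∉ R := fun hR => (hD.mem_of_removed h hR).elim h1 fun h3 => h2 h3.2
        rw [complState_of_notMem h1, complState_of_notMem h2, ((hs h).2 hR).2 hc]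

/-- Cells in `F` weigh 1 on both sides; the summand 1 in the exponent for each of them cancels the
-1 of the general cell formula. -/
lemma prod_cellWeight_complState [Fintype C] {s : C → Bool → Bool → Bool}
    (hs : ∀ c ∈ F, ∀ k x, s c k x = false) {K : ℕ} (hK : ∑ c, cellCount (s c) = K) :
    ((∏ c, cellWeight (s c) : ℕ) : ℚ) = 2 ^ ((K : ℤ) - Fintype.card C + F.ncard) *
      ((∏ c, cellWeight (complState F s c) : ℕ) : ℚ) := by
  classical
  have h1 : ∀ c, (cellWeight (s c) : ℚ) =
      2 ^ ((cellCount (s c) : ℤ) - 1 + if c ∈ F then 1 else 0) *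
        cellWeight (complState F s c) := by
    intro c
    by_cases h : c ∈ F
    · have h2 : complState F s c = fun _ _ => false := by
        funext k x; exact complState_of_mem h k x
      have h3 : s c = fun _ _ => false := by
        funext k x; exact hs c h k x
      rw [h2, h3, cellWeight_false, if_pos h]
      norm_num [cellCount]
    · have h2 : complState F s c = fun k x => !(s c k x) := by
        funext k x; exact complState_of_notMem h k x
      rw [h2, if_neg h, add_zero]
      exact two_mul_cellWeight _
  have h2 : (K : ℤ) - Fintype.card C + F.ncard =
      ∑ c, ((cellCount (s c) : ℤ) - 1 + if c ∈ F then 1 else 0) := by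
    rw [sum_add_distrib, sum_sub_distrib, ← hK]
    simp [Set.ncard_eq_toFinset_card', Set.toFinset_card]
  rw [h2]
  push_cast
  rw [← prod_zpow_eq _ _ two_ne_zero]
  rw [← prod_mul_distrib]
  exact prod_congr rfl fun c _ => h1 c

open Classical in
/-- The complementation identity for the weighted numbers of states. -/
lemma sum_prod_cellWeight [Fintype C] (hD : ComplementaryDefects opp H R cut F) {K : ℕ}
    (hK : ∀ s, ValidState opp H ∅ s → ∑ c, cellCount (s c) = K)
    (hpos : ∑ s ∈ univ.filter (fun s : C → Bool → Bool → Bool => ValidState opp H ∅ s),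
        ∏ c, cellWeight (s c) ≠ 0) :
    ((∑ s ∈ univ.filter (fun s : C → Bool → Bool → Bool => ValidState opp H ∅ s),
        ∏ c, cellWeight (s c) : ℕ) : ℚ) = 2 ^ ((K : ℤ) - Fintype.card C + F.ncard) *
      ((∑ s ∈ univ.filter (fun s : C → Bool → Bool → Bool => ValidState opp R cut s),
        ∏ c, cellWeight (s c) : ℕ) : ℚ) := by
  have hne : ∀ s : C → Bool → Bool → Bool, ∏ c, cellWeight (s c) ≠ 0 →
      ∀ c, cellWeight (s c) ≠ 0 := fun s hs c => Finset.prod_ne_zero_iff.1 hs c (mem_univ c)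
  obtain ⟨s₀, hs₀, hw₀⟩ := exists_ne_zero_of_sum_ne_zero hpos
  have hex : ∀ h ∉ H, h.1 ∈ F → (opp h).1 ∉ F := fun h hh h1 =>
    hD.not_mem_and_mem (by simpa using hs₀) (hne _ hw₀) hh h1
  push_cast
  rw [mul_sum]
  -- The bijection is between states of nonzero weight only: these are empty on `F`, which makes
  -- complementation outside `F` an involution.
  refine sum_bij_ne_zero (fun s _ _ => complState F s) ?_ ?_ ?_ ?_
  · intro s hs hw
    have hw' := hne s (by exact_mod_cast hw)
    simpa using hD.validState_complState (by simpa using hs) hw'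
  · intro s hs hw s' hs' hw' h
    have h1 := hD.eq_false_of_validState (s := s) (by simpa using hs)
      (hne s (by exact_mod_cast hw))
    have h2 := hD.eq_false_of_validState (s := s') (by simpa using hs')
      (hne s' (by exact_mod_cast hw'))
    rw [← complState_complState h1, h, complState_complState h2]
  · intro s hs hw
    have hw' := hne s (by exact_mod_cast right_ne_zero_of_mul hw)
    have hs' : ValidState opp R cut s := by simpa using hs
    refine ⟨complState F s, ?_, ?_, ?_⟩
    · simpa using hD.validState_complState' hex hs' hw'
    · have := Finset.prod_ne_zero_iff.2 fun c (_ : c ∈ univ) =>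
        cellWeight_complState (F := F) hw' c
      exact_mod_cast this
    · exact complState_complState (hD.eq_false_of_validState' hs' hw')
  · intro s hs hw
    have hw' := hne s (by exact_mod_cast hw)
    have hs' : ValidState opp H ∅ s := by simpa using hs
    have := prod_cellWeight_complState (hD.eq_false_of_validState hs' hw') (hK s hs')
    exact_mod_cast this

end ComplementaryDefects

end Complement

/-! ### The decomposition of the torus into cells -/

/-- The parity of a coordinate. -/
def par {k : ℕ} (x : ZMod (2 * k)) : ZMod 2 := ZMod.castHom (dvd_mul_right 2 k) (ZMod 2) x

section Par

variable {k : ℕ}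

lemma par_add (x y : ZMod (2 * k)) : par (x + y) = par x + par y := map_add _ _ _
lemma par_sub (x y : ZMod (2 * k)) : par (x - y) = par x - par y := map_sub _ _ _
lemma par_one : par (1 : ZMod (2 * k)) = 1 := map_one _
lemma par_intCast (i : ℤ) : par (i : ZMod (2 * k)) = (i : ZMod 2) := map_intCast _ _
lemma par_natCast (i : ℕ) : par (i : ZMod (2 * k)) = (i : ZMod 2) := map_natCast _ _

lemma sgn_true : (sgn true : ZMod k) = 1 := rfl
lemma sgn_false : (sgn false : ZMod k) = -1 := rfl
lemma sgn_not (b : Bool) : (sgn (!b) : ZMod k) = -sgn b := by cases b <;> simp [sgn]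

lemma par_sgn (b : Bool) : par (sgn b : ZMod (2 * k)) = 1 := by
  cases b
  · rw [sgn_false, par, map_neg, map_one]; rfl
  · exact par_one

lemma zmod_two_add_one_add_one (a : ZMod 2) : a + 1 + 1 = a := by revert a; decide
lemma zmod_two_add_one_ne (a : ZMod 2) : a + 1 ≠ a := by revert a; decide
lemma zmod_two_sub_one_ne (a : ZMod 2) : a - 1 ≠ a := by revert a; decide
lemma zmod_two_ne {a b : ZMod 2} : a ≠ b ↔ a = b + 1 := by revert a b; decide

end Par

/-! ### Cells, their half vertices and their edges. -/

variable {m n : ℕ}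

lemma isVertex_iff {p : Square m n} : IsVertex p ↔ par p.1 = par p.2 + 1 := by
  change par p.1 + par p.2 = 1 ↔ _
  generalize par p.1 = a
  generalize par p.2 = b
  revert a b; decide

/-- The four-cycles around the squares both of whose coordinates have parity `η`. -/
abbrev Cell (m n : ℕ) (η : ZMod 2) := {c : Square m n // par c.1 = η ∧ par c.2 = η}

/-- A vertex of a cell: to the right or left of its centre, or above or below it. -/
abbrev Half (m n : ℕ) (η : ZMod 2) := Cell m n η × Bool × Bool

variable {η : ZMod 2}

/-- The vertex of `T_{m,n}` that a vertex of a cell comes from. -/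
def pos (h : Half m n η) : Square m n :=
  if h.2.1 then (h.1.1.1 + sgn h.2.2, h.1.1.2) else (h.1.1.1, h.1.1.2 + sgn h.2.2)

lemma pos_true (c : Cell m n η) (x : Bool) : pos (c, true, x) = (c.1.1 + sgn x, c.1.2) := rfl
lemma pos_false (c : Cell m n η) (x : Bool) : pos (c, false, x) = (c.1.1, c.1.2 + sgn x) := rfl

lemma par_pos_true (c : Cell m n η) (x : Bool) : par (pos (c, true, x)).1 = η + 1 := by
  rw [pos_true, par_add, par_sgn, c.2.1]

lemma par_pos_false (c : Cell m n η) (x : Bool) : par (pos (c, false, x)).1 = η := c.2.1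

lemma isVertex_pos (h : Half m n η) : IsVertex (pos h) := by
  rw [isVertex_iff]
  obtain ⟨c, k, x⟩ := h
  cases k
  · rw [pos_false, par_add, par_sgn, c.2.1, c.2.2, zmod_two_add_one_add_one]
  · rw [pos_true, par_add, par_sgn, c.2.1, c.2.2]

/-- The other cell vertex coming from the same vertex of `T_{m,n}`. -/
def opp (h : Half m n η) : Half m n η :=
  if h.2.1 then (⟨(h.1.1.1 + sgn h.2.2 + sgn h.2.2, h.1.1.2), by
    simp only [par_add, par_sgn, h.1.2.1, h.1.2.2, and_true]
    exact zmod_two_add_one_add_one η⟩, true, !h.2.2)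
  else (⟨(h.1.1.1, h.1.1.2 + sgn h.2.2 + sgn h.2.2), by
    simp only [par_add, par_sgn, h.1.2.1, h.1.2.2, true_and]
    exact zmod_two_add_one_add_one η⟩, false, !h.2.2)

lemma opp_true_fst (c : Cell m n η) (x : Bool) :
    (opp (c, true, x)).1.1 = (c.1.1 + sgn x + sgn x, c.1.2) := rfl
lemma opp_false_fst (c : Cell m n η) (x : Bool) :
    (opp (c, false, x)).1.1 = (c.1.1, c.1.2 + sgn x + sgn x) := rfl

lemma opp_snd_fst (h : Half m n η) : (opp h).2.1 = h.2.1 := by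
  obtain ⟨c, k, x⟩ := h
  cases k <;> rfl

lemma opp_snd_snd (h : Half m n η) : (opp h).2.2 = !h.2.2 := by
  obtain ⟨c, k, x⟩ := h
  cases k <;> rfl

/-- The side is flipped. This works even when m = 1 or n = 1, where both halves of a vertex may lie
in the same cell. -/
lemma opp_ne (h : Half m n η) : opp h ≠ h := by
  intro h1
  have h2 := opp_snd_snd h
  rw [h1] at h2
  revert h2
  cases h.2.2 <;> decide

lemma half_ext {h h' : Half m n η} (h1 : h.1.1 = h'.1.1) (h2 : h.2.1 = h'.2.1)
    (h3 : h.2.2 = h'.2.2) : h = h' :=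
  Prod.ext (Subtype.ext h1) (Prod.ext h2 h3)

lemma opp_opp (h : Half m n η) : opp (opp h) = h := by
  refine half_ext ?_ (by simp [opp_snd_fst]) (by simp [opp_snd_snd])
  obtain ⟨c, k, x⟩ := h
  cases k <;> simp [opp, sgn_not]

lemma pos_opp (h : Half m n η) : pos (opp h) = pos h := by
  obtain ⟨c, k, x⟩ := h
  cases k <;> simp [opp, pos, sgn_not]

lemma kind_eq_of_pos_eq {h h' : Half m n η} (hp : par (pos h).1 = par (pos h').1) :
    h.2.1 = h'.2.1 := by
  obtain ⟨c, k, x⟩ := h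
  obtain ⟨c', k', x'⟩ := h'
  cases k <;> cases k' <;> simp only [par_pos_true, par_pos_false] at hp ⊢
  · revert η; simp
  · revert η; simp

/-- The parity of the horizontal coordinate tells the kind of a half; after that only the side is
free. -/
lemma pos_eq_iff (h h' : Half m n η) : pos h' = pos h ↔ h' = h ∨ h' = opp h := by
  constructor
  · intro hp
    have hk := kind_eq_of_pos_eq (congrArg (fun p => par p.1) hp)
    by_cases hx : h'.2.2 = h.2.2
    · refine Or.inl (half_ext ?_ hk hx)
      obtain ⟨c, k, x⟩ := h
      obtain ⟨c', k', x'⟩ := h'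
      dsimp only at hk hx
      subst hk hx
      cases k' <;> simpa [pos, Prod.ext_iff] using hp
    · have hx' : h'.2.2 = !h.2.2 := by
        revert hx; cases h'.2.2 <;> cases h.2.2 <;> simp
      refine Or.inr (half_ext ?_ (by rw [opp_snd_fst, hk]) (by rw [opp_snd_snd, hx']))
      obtain ⟨c, k, x⟩ := h
      obtain ⟨c', k', x'⟩ := h'
      dsimp only at hk hx'
      subst hk hx'
      cases k'
      · simp only [pos_false, sgn_not, Prod.mk.injEq] at hp
        rw [opp_false_fst, ← hp.2, hp.1.symm]
        simp
      · simp only [pos_true, sgn_not, Prod.mk.injEq] at hp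
        rw [opp_true_fst, ← hp.1, hp.2.symm]
        simp
  · rintro (rfl | rfl)
    · rfl
    · exact pos_opp h

/-- The cell vertex that belongs to the vertex `p` and is met by the edges leaving `p` in
direction `d`. -/
lemma exists_half {p : Square m n} (hp : IsVertex p) (d : Bool × Bool) :
    ∃ h : Half m n η, pos h = p ∧ h.2.2 = !(if h.2.1 then d.1 else d.2) := by
  rw [isVertex_iff] at hp
  by_cases h : par p.1 = η
  · refine ⟨(⟨(p.1, p.2 + sgn d.2), h, ?_⟩, false, !d.2), ?_, rfl⟩
    · rw [par_add, par_sgn, ← hp, h]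
    · simp [pos_false, sgn_not]
  · refine ⟨(⟨(p.1 + sgn d.1, p.2), ?_, ?_⟩, true, !d.1), ?_, rfl⟩
    · rw [par_add, par_sgn, zmod_two_ne.1 h, zmod_two_add_one_add_one]
    · rw [zmod_two_ne.1 h] at hp; exact (add_right_cancel hp).symm
    · simp [pos_true, sgn_not]

/-- The edge of `T_{m,n}` joining the vertex of the cell `c` on the horizontal side `d.1` to the
one on the vertical side `d.2`. -/
def cellEdge (e : Half m n η) : Square m n × Bool :=
  if e.2.1 then (pos (e.1, false, e.2.2), !e.2.2) else (pos (e.1, true, false), e.2.2)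

lemma cellEdge_true (c : Cell m n η) (y : Bool) :
    cellEdge (c, true, y) = ((c.1.1, c.1.2 + sgn y), !y) := rfl

lemma cellEdge_false (c : Cell m n η) (y : Bool) :
    cellEdge (c, false, y) = ((c.1.1 - 1, c.1.2), y) := by
  simp [cellEdge, pos_true, sgn_false, sub_eq_add_neg]

lemma cellEdge_injective : Function.Injective (cellEdge : Half m n η → _) := by
  rintro ⟨c, x, y⟩ ⟨c', x', y'⟩ h
  -- The stored left end is the left vertex of the cell or its upper or lower one, and the parity of
  -- its horizontal coordinate tells which.
  have hx : x = x' := by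
    have h1 := congrArg (fun e => par e.1.1) h
    cases x <;> cases x' <;> simp only [cellEdge_true, cellEdge_false, par_sub, par_one, c.2.1,
      c'.2.1] at h1 ⊢
    · exact absurd h1 (zmod_two_sub_one_ne η)
    · exact absurd h1.symm (zmod_two_sub_one_ne η)
  subst hx
  cases x
  · simp only [cellEdge_false, Prod.mk.injEq, sub_left_inj] at h
    exact half_ext (Prod.ext h.1.1 h.1.2) rfl h.2
  · simp only [cellEdge_true, Prod.mk.injEq] at h
    obtain ⟨⟨h1, h2⟩, h3⟩ := h
    have h3' : y = y' := by revert h3; cases y <;> cases y' <;> simp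
    subst h3'
    exact half_ext (Prod.ext h1 (add_right_cancel h2)) rfl rfl

lemma exists_cellEdge {e : Square m n × Bool} (he : IsVertex e.1) :
    ∃ c d, cellEdge ((c, d) : Half m n η) = e := by
  obtain ⟨p, b⟩ := e
  obtain ⟨⟨c, k, x⟩, h1, h2⟩ := exists_half (η := η) he (true, b)
  dsimp only at h1 h2
  cases k
  · refine ⟨c, (true, !b), ?_⟩
    rw [cellEdge, ← h1]
    simp [h2]
  · refine ⟨c, (false, b), ?_⟩
    rw [cellEdge, ← h1]
    simp [h2]

lemma isVertex_cellEdge (e : Half m n η) : IsVertex (cellEdge e).1 := by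
  unfold cellEdge
  split_ifs <;> exact isVertex_pos _

lemma diag_cellEdge (c : Cell m n η) (d : Bool × Bool) :
    diag (cellEdge (c, d)).1 (true, (cellEdge (c, d)).2) =
      if d.1 then pos (c, true, true) else pos (c, false, d.2) := by
  obtain ⟨x, y⟩ := d
  cases x
  · simp [cellEdge_false, diag, sgn_true, pos_false]
  · simp [cellEdge_true, diag, sgn_true, pos_true, sgn_not]

/-! ### Separated and punctured tori as gluings of cells. -/

section Attach

variable {α : Type*} {A : Square m n → Bool × Bool → α}

/-- The vertex of a graph obtained by separations that a cell vertex is identified with. -/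
def attach (A : Square m n → Bool × Bool → α) (h : Half m n η) : α := A (pos h) (!h.2.2, !h.2.2)

/-- A graph obtained from `T_{m,n}` by separations and deletions of vertices is glued from its
cells. -/
lemma isGluing_attach {G : Graph α (Square m n × Bool)} {R : Set α}
    (hlink : ∀ e x y, G.IsLink e x y ↔ IsVertex e.1 ∧ (x ∉ R ∧ y ∉ R) ∧
      ((x = A e.1 (true, e.2) ∧ y = A (diag e.1 (true, e.2)) (false, !e.2)) ∨
        (y = A e.1 (true, e.2) ∧ x = A (diag e.1 (true, e.2)) (false, !e.2))))
    (hvert : ∀ v, v ∈ G.vertexSet ↔ v ∉ R ∧ ∃ p d, IsVertex p ∧ v = A p d)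
    (hW : ∀ p, par p.1 = η + 1 → ∀ a b b', A p (a, b) = A p (a, b'))
    (hB : ∀ p, par p.1 = η → ∀ a a' b, A p (a, b) = A p (a', b))
    (hinj : ∀ p p' d d', A p d = A p' d' → p = p') :
    IsGluing G (cellEdge : Half m n η → _) (attach A) R where
  inj := cellEdge_injective
  link := by
    -- Edges of a cell leave its vertex on side x in the direction opposite to x, whence the negated
    -- side in `attach`. The component of the direction along the other axis is irrelevant by `hW`
    -- and `hB`.
    have hends : ∀ (c : Cell m n η) (d : Bool × Bool),
        (A (cellEdge (c, d)).1 (true, (cellEdge (c, d)).2) =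
            attach A (if d.1 then (c, false, d.2) else (c, true, d.1))) ∧
          A (diag (cellEdge (c, d)).1 (true, (cellEdge (c, d)).2)) (false, !(cellEdge (c, d)).2) =
            attach A (if d.1 then (c, true, d.1) else (c, false, d.2)) := by
      rintro c ⟨x, y⟩
      rw [diag_cellEdge]
      cases x
      · exact ⟨hW _ (par_pos_true _ _) _ _ _, hB _ (par_pos_false _ _) _ _ _⟩
      · refine ⟨hB _ (par_pos_false _ _) _ _ _, hW _ (par_pos_true _ _) _ _ _⟩
    intro e x y
    rw [hlink]
    constructor
    · rintro ⟨he, ⟨hx, hy⟩, h⟩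
      obtain ⟨c, d, rfl⟩ := exists_cellEdge (η := η) he
      rw [(hends c d).1, (hends c d).2] at h
      obtain ⟨a, b⟩ := d
      have h' : (x = attach A (c, true, a) ∧ y = attach A (c, false, b)) ∨
          (y = attach A (c, true, a) ∧ x = attach A (c, false, b)) := by
        cases a
        · exact h
        · exact h.symm.imp And.symm And.symm
      refine ⟨c, (a, b), rfl, ?_, ?_, h'⟩
      · rcases h' with ⟨rfl, -⟩ | ⟨rfl, -⟩ <;> assumption
      · rcases h' with ⟨-, rfl⟩ | ⟨-, rfl⟩ <;> assumption
    · rintro ⟨c, d, rfl, h1, h2, h⟩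
      refine ⟨isVertex_cellEdge _, ?_, ?_⟩
      · rcases h with ⟨rfl, rfl⟩ | ⟨rfl, rfl⟩
        · exact ⟨h1, h2⟩
        · exact ⟨h2, h1⟩
      · rw [(hends c d).1, (hends c d).2]
        obtain ⟨a, b⟩ := d
        cases a
        · exact h
        · exact h.symm.imp And.symm And.symm
  vert := by
    intro v
    rw [hvert]
    refine and_congr Iff.rfl ⟨?_, ?_⟩
    · rintro ⟨p, d, hp, rfl⟩
      obtain ⟨⟨c, k, x⟩, rfl, h⟩ := exists_half (η := η) hp d
      refine ⟨(c, k, x), ?_⟩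
      obtain ⟨a, b⟩ := d
      cases k
      · obtain rfl : x = !b := h
        simpa [attach] using hB _ (par_pos_false _ _) _ _ _
      · obtain rfl : x = !a := h
        simpa [attach] using hW _ (par_pos_true _ _) _ _ _
    · rintro ⟨h, rfl⟩
      exact ⟨_, _, isVertex_pos h, rfl⟩
  ne := by
    intro c c' x x' h
    have := kind_eq_of_pos_eq (congrArg (fun p => par p.1) (hinj _ _ _ _ h))
    exact absurd this (by simp)

end Attach

lemma isGluing_torusWithWindows {r : ℕ} (O : Fin r → Window m n) :
    IsGluing (torusWithWindows O) (cellEdge : Half m n η → _) pos (⋃ i, (O i).vertices) := by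
  refine isGluing_attach (A := fun p _ => p) ?_ ?_ (fun _ _ _ _ _ => rfl) (fun _ _ _ _ _ => rfl)
    (fun _ _ _ _ h => h)
  · intro e x y
    rw [torusWithWindows, Graph.deleteVerts_isLink]
    change (IsVertex e.1 ∧ _) ∧ _ ↔ _
    tauto
  · intro v
    rw [torusWithWindows, Graph.vertexSet_deleteVerts]
    change (IsVertex v ∧ _) ↔ _
    constructor
    · rintro ⟨h1, h2⟩
      exact ⟨h2, v, (true, true), h1, rfl⟩
    · rintro ⟨h1, p, d, h2, rfl⟩
      exact ⟨h2, h1⟩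

lemma isLink_torus_diag {e : Square m n × Bool} :
    (torus m n).IsLink e e.1 (diag e.1 (true, e.2)) ↔ IsVertex e.1 := by
  constructor
  · exact fun h => h.1
  · exact fun h => ⟨h, Or.inl ⟨rfl, rfl⟩⟩

/-- A vertex of horizontal parity η + 1 has its two cells to the left and right, and one of parity η
has them above and below. Each separation therefore splits the vertex precisely into its two halves.
-/
lemma isGluing_torusWithDefects {r : ℕ} (D : Fin r → Defect m n)
    (hV : ∀ p ∈ ⋃ i, (D i).verticalCuts, par p.1 = η + 1)
    (hH : ∀ p ∈ ⋃ i, (D i).horizontalCuts, par p.1 = η) :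
    IsGluing (torusWithDefects D) (cellEdge : Half m n η → _)
      (attach (copyAt (⋃ i, (D i).verticalCuts) (⋃ i, (D i).horizontalCuts)))
      (⋃ i, (D i).removed) := by
  refine isGluing_attach ?_ ?_ ?_ ?_ ?_
  · intro e x y
    rw [torusWithDefects, Graph.deleteVerts_isLink]
    simp only [separatedTorus]
    constructor
    · rintro ⟨⟨q, h1, rfl, h2⟩, h3⟩
      exact ⟨isLink_torus_diag.1 h1, h3, h2⟩
    · rintro ⟨h1, h3, h2⟩
      exact ⟨⟨_, isLink_torus_diag.2 h1, rfl, h2⟩, h3⟩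
  · intro v
    rw [torusWithDefects, Graph.vertexSet_deleteVerts]
    exact and_comm
  · intro p hp a b b'
    have h : p ∉ ⋃ i, (D i).horizontalCuts := fun h => zmod_two_add_one_ne η (hp.symm.trans (hH p h))
    simp only [copyAt, h, if_false]
  · intro p hp a a' b
    have h : p ∉ ⋃ i, (D i).verticalCuts := fun h => zmod_two_add_one_ne η ((hV p h).symm.trans hp)
    simp only [copyAt, h, if_false]
  · intro p p' d d' h
    exact congrArg Prod.fst h

lemma attach_copyAt_eq_iff {CV CH : Set (Square m n)} (h h' : Half m n η) :
    attach (copyAt CV CH) h' = attach (copyAt CV CH) h ↔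
      h' = h ∨ (h' = opp h ∧ h ∉ {h | pos h ∈ CV ∪ CH}) := by
  constructor
  · intro he
    have hp : pos h' = pos h := congrArg Prod.fst he
    rcases (pos_eq_iff h h').1 hp with h1 | h1
    · exact Or.inl h1
    · refine Or.inr ⟨h1, ?_⟩
      rintro (h2 | h2)
      · have := congrArg (fun x => x.2.1) he
        simp only [attach, copyAt, if_pos h2, h1, opp_snd_snd] at this
        revert this; cases h.2.2 <;> simp
      · have := congrArg (fun x => x.2.2) he
        simp only [attach, copyAt, if_pos h2, h1, opp_snd_snd] at this
        revert this; cases h.2.2 <;> simp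
  · rintro (rfl | ⟨rfl, h1⟩)
    · rfl
    · have h2 : pos h ∉ CV := fun h2 => h1 (Or.inl h2)
      have h3 : pos h ∉ CH := fun h2 => h1 (Or.inr h2)
      simp only [attach, copyAt, pos_opp, h2, h3, if_false]

/-! ### Intervals in the cyclic groups of coordinates -/

/-- `x` is at distance at most `l` from `c`. -/
def Near {N : ℕ} (c : ZMod (2 * N)) (l : ℕ) (x : ZMod (2 * N)) : Prop :=
  ∃ i : ℤ, (-(l : ℤ) ≤ i ∧ i ≤ l) ∧ x = c + i

section Near

variable {N l : ℕ} {c x : ZMod (2 * N)}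

lemma sgn_eq_intCast {k : ℕ} (b : Bool) : ∃ s : ℤ, (s = 1 ∨ s = -1) ∧ (sgn b : ZMod k) = s := by
  cases b
  · exact ⟨-1, Or.inr rfl, by simp [sgn]⟩
  · exact ⟨1, Or.inl rfl, by simp [sgn]⟩

/-- The modulus is even, so the parity of an offset is well defined although the offset is not. -/
lemma par_add_intCast (i : ℤ) : par (c + (i : ZMod (2 * N))) = par (c + (l : ZMod (2 * N))) ↔ Even (i + l) := by
  rw [par_add, par_add, par_intCast, par_natCast, add_right_inj, ← Int.cast_natCast l,
    ← sub_eq_zero, ← Int.cast_sub, ZMod.intCast_zmod_eq_zero_iff_dvd, Int.even_iff]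
  push_cast
  omega

lemma Near.mono {l' : ℕ} (h : Near c l x) (hl : l ≤ l') : Near c l' x := by
  obtain ⟨i, hi, rfl⟩ := h
  exact ⟨i, by omega, rfl⟩

lemma Near.add_sgn (h : Near c l x) (b : Bool) : Near c (l + 1) (x + sgn b) := by
  obtain ⟨i, hi, rfl⟩ := h
  obtain ⟨s, hs, hb⟩ := sgn_eq_intCast (k := 2 * N) b
  refine ⟨i + s, by push_cast; omega, by rw [hb]; push_cast; ring⟩

lemma Near.of_add_sgn {b : Bool} (h : Near c l (x + sgn b)) : Near c (l + 1) x := by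
  have := h.add_sgn (!b)
  rwa [sgn_not, add_neg_cancel_right] at this

/-- The offsets ±l have the wrong parity, so the interval can be shrunk by one. -/
lemma Near.pred (h : Near c l x) (hp : par x ≠ par (c + (l : ZMod (2 * N)))) : 1 ≤ l ∧ Near c (l - 1) x := by
  obtain ⟨i, hi, rfl⟩ := h
  rw [ne_eq, par_add_intCast, Int.even_iff] at hp
  exact ⟨by omega, i, by omega, rfl⟩

/-- The offsets ±(l + 1) have the wrong parity. This needs no bound on l, so it also covers an
evolved hole that wraps around the torus. -/
lemma Near.of_succ (h : Near c (l + 1) x) (hp : par x = par (c + (l : ZMod (2 * N)))) : Near c l x := by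
  obtain ⟨i, hi, rfl⟩ := h
  rw [par_add_intCast, Int.even_iff] at hp
  exact ⟨i, by push_cast at hi; omega, rfl⟩

/-- Every point of the larger interval with the parity of its ends has a neighbour in the smaller
one; at an end it is the inner neighbour. -/
lemma Near.add_or_sub {b : Bool} (h : Near c (l + 1) (x + sgn b)) (hp : par x = par (c + (l : ZMod (2 * N)))) :
    Near c l x ∨ Near c l (x + sgn b + sgn b) := by
  obtain ⟨i, hi, h⟩ := h
  obtain ⟨s, hs, hb⟩ := sgn_eq_intCast (k := 2 * N) b
  have hx : x = c + ((i - s : ℤ) : ZMod (2 * N)) := by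
    rw [← add_sub_cancel_right x (sgn b), h, hb]; push_cast; ring
  rw [hx, par_add_intCast, Int.even_iff] at hp
  by_cases h1 : -(l : ℤ) ≤ i - s ∧ i - s ≤ l
  · exact Or.inl ⟨i - s, h1, hx⟩
  · refine Or.inr ⟨i + s, by push_cast at hi; omega, ?_⟩
    rw [h, hb]; push_cast; ring

/-- The bound l < N prevents two points at distance two from both being in the interval by going
round the circle the other way. -/
lemma Near.mid {b : Bool} (h : Near c l x) (h' : Near c l (x + sgn b + sgn b))
    (hl : l < N) (hp : par x ≠ par (c + (l : ZMod (2 * N)))) : Near c (l - 1) (x + sgn b) := by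
  have hp' : par (x + sgn b + sgn b) ≠ par (c + (l : ZMod (2 * N))) := by
    rwa [par_add, par_add, par_sgn, zmod_two_add_one_add_one]
  obtain ⟨h1, i, hi, rfl⟩ := h.pred hp
  obtain ⟨-, j, hj, h2⟩ := h'.pred hp'
  obtain ⟨s, hs, hb⟩ := sgn_eq_intCast (k := 2 * N) b
  rw [hb] at h2 ⊢
  have h3 : ((i + 2 * s - j : ℤ) : ZMod (2 * N)) = 0 := by
    push_cast
    linear_combination h2
  rw [ZMod.intCast_zmod_eq_zero_iff_dvd] at h3
  have h4 := Int.eq_zero_of_abs_lt_dvd h3 (abs_lt.2 (by push_cast; omega))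
  exact ⟨i + s, by omega, by push_cast; ring⟩

end Near

lemma mem_board {c p : Square m n} {k l : ℕ} :
    p ∈ board c k l ↔ Near c.1 l p.1 ∧ Near c.2 k p.2 := by
  constructor
  · rintro ⟨i, j, hi, hj, rfl⟩
    exact ⟨⟨i, abs_le.1 hi, rfl⟩, ⟨j, abs_le.1 hj, rfl⟩⟩
  · rintro ⟨⟨i, hi, h1⟩, ⟨j, hj, h2⟩⟩
    exact ⟨i, j, abs_le.2 hi, abs_le.2 hj, Prod.ext h1 h2⟩

/-! ### Windows and their evolved forms -/

/-- The relations between a window on the squares in `S` and its evolved form, which removes the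
vertices on the squares in `E` and separates those in `K`. The ends of kind `k` of the cells in the
window are on the window. -/
structure LocalEvolution (η : ZMod 2) (S E K : Set (Square m n)) (k : Bool) : Prop where
  pos_mem : ∀ (c : Cell m n η) x, c.1 ∈ S → pos (c, k, x) ∈ S
  mem_of_pos : ∀ (c : Cell m n η) x, pos (c, !k, x) ∈ S → c.1 ∈ S
  pos_mem_evolved : ∀ (c : Cell m n η) x, c.1 ∈ S → pos (c, !k, x) ∈ E
  mem_evolved_iff : ∀ c : Cell m n η, c.1 ∈ E ↔ c.1 ∈ S
  mem_of_pos_evolved : ∀ (c : Cell m n η) x, pos (c, k, x) ∈ E → c.1 ∈ S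
  mem_or_mem_of_pos_evolved : ∀ (c : Cell m n η) x, pos (c, !k, x) ∈ E →
    c.1 ∈ S ∨ (opp (c, !k, x)).1.1 ∈ S
  mem_or_mem_of_pos : ∀ (c : Cell m n η) x, pos (c, k, x) ∈ S → pos (c, k, x) ∉ K →
    c.1 ∈ S ∨ (opp (c, k, x)).1.1 ∈ S
  cuts_subset : K ⊆ S
  cuts_eq_empty : ∀ c : Cell m n η, c.1 ∈ S → K = ∅
  pos_mem_evolved_of_mem_mem : ∀ (c : Cell m n η) x, c.1 ∈ S → (opp (c, k, x)).1.1 ∈ S →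
    pos (c, k, x) ∈ E

/-- Each window satisfies the conditions by itself; the work lies in windows that touch. Conflicts
between two of them reduce to a common square, which disjointness forbids, or to the rule that a
hole removes only the copies on its own side. -/
lemma LocalEvolution.complementaryDefects {ι : Type*} {S E K : ι → Set (Square m n)}
    {k : ι → Bool} (hL : ∀ i, LocalEvolution η (S i) (E i) (K i) (k i))
    (hS : ∀ i j p, p ∈ S i → p ∈ S j → i = j) :
    ComplementaryDefects (opp : Half m n η → _) {h | ∃ i, pos h ∈ S i}
      {h | ∃ i, pos h ∈ E i ∧ ((∃ j, pos h ∈ K j) → h.1.1 ∈ E i)} {h | ∃ j, pos h ∈ K j}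
      {c | ∃ i, c.1 ∈ S i} := by
  have hmem : ∀ (h : Half m n η) i, pos h ∈ S i → pos h ∉ K i →
      h.1.1 ∈ S i ∨ (opp h).1.1 ∈ S i := by
    rintro ⟨c, k', x⟩ i hi hK
    rcases Bool.eq_or_eq_not k' (k i) with rfl | rfl
    · exact (hL i).mem_or_mem_of_pos c x hi hK
    · exact Or.inl ((hL i).mem_of_pos c x hi)
  have hrem : ∀ (h : Half m n η) i, h.1.1 ∈ S i → h.2.1 = (!k i) →
      ∃ i, pos h ∈ E i ∧ ((∃ j, pos h ∈ K j) → h.1.1 ∈ E i) := by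
    rintro ⟨c, k', x⟩ i hi hk
    dsimp only at hk
    subst hk
    exact ⟨i, (hL i).pos_mem_evolved c x hi, fun _ => ((hL i).mem_evolved_iff c).2 hi⟩
  have hpos : ∀ (h : Half m n η) i, h.1.1 ∈ S i → h.2.1 = k i → pos h ∈ S i := by
    rintro ⟨c, k', x⟩ i hi hk
    dsimp only at hk
    subst hk
    exact (hL i).pos_mem c x hi
  have hopp : ∀ h : Half m n η, (¬ ∃ j, pos h ∈ K j) →
      (∃ i, pos h ∈ E i ∧ ((∃ j, pos h ∈ K j) → h.1.1 ∈ E i)) →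
      (∃ i, pos (opp h) ∈ E i ∧ ((∃ j, pos (opp h) ∈ K j) → (opp h).1.1 ∈ E i)) := by
    rintro h hc ⟨i, hi, -⟩
    rw [pos_opp]
    exact ⟨i, hi, fun hc' => absurd hc' hc⟩
  refine ⟨opp_opp, ?_, hopp, ?_, ?_, ?_, ?_, ?_, ?_, ?_, ?_⟩
  · rintro h ⟨i, hi⟩
    exact ⟨i, by rwa [pos_opp]⟩
  · rintro h ⟨i, hi⟩
    exact ⟨i, (hL i).cuts_subset hi⟩
  · rintro c ⟨i, hi⟩
    exact ⟨k i, fun x => ⟨i, (hL i).pos_mem c x hi⟩⟩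
  · rintro c ⟨i, hi⟩
    exact ⟨!k i, fun x => hrem _ i hi rfl⟩
  · rintro ⟨c, k', x⟩ ⟨i, hi, hcut⟩
    rcases Bool.eq_or_eq_not k' (k i) with rfl | rfl
    · exact Or.inl ⟨i, (hL i).mem_of_pos_evolved c x hi⟩
    rcases (hL i).mem_or_mem_of_pos_evolved c x hi with h1 | h1
    · exact Or.inl ⟨i, h1⟩
    -- Here the opposite cell is in window `i`. If the vertex is separated, the copy rule puts the
    -- present cell in window `i` too. If it lies unseparated in a window, one of its two cells is
    -- in that window, and disjointness settles the case of the opposite cell.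
    by_cases hc : ∃ j, pos (c, !k i, x) ∈ K j
    · exact Or.inl ⟨i, ((hL i).mem_evolved_iff c).1 (hcut hc)⟩
    by_cases hH : ∃ j, pos (c, !k i, x) ∈ S j
    · obtain ⟨j, hj⟩ := hH
      rcases hmem _ j hj (fun h2 => hc ⟨j, h2⟩) with h2 | h2
      · exact Or.inl ⟨j, h2⟩
      · obtain rfl := hS _ _ _ h1 h2
        exact Or.inl ⟨i, (hL i).mem_of_pos c x hj⟩
    · exact Or.inr ⟨hH, i, h1⟩
  · rintro h ⟨j, hj⟩ ⟨i, hi⟩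
    rcases Bool.eq_or_eq_not h.2.1 (k i) with hk | hk
    -- The vertex would lie in both windows, so they coincide; but a window that contains a cell
    -- evolves without separations.
    · obtain rfl := hS _ _ _ (hpos h i hi hk) ((hL j).cuts_subset hj)
      rw [(hL i).cuts_eq_empty _ hi] at hj
      exact absurd hj (Set.notMem_empty _)
    · exact hrem h i hi hk
  · rintro h hH ⟨i, hi⟩
    rcases Bool.eq_or_eq_not h.2.1 (k i) with hk | hk
    · exact absurd ⟨i, hpos h i hi hk⟩ hH
    · exact hrem h i hi hk
  · rintro h hH hc ⟨i, hi⟩ ⟨j, hj⟩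
    rcases Bool.eq_or_eq_not h.2.1 (k i) with hk | hk
    -- If the vertex is an end of the window's own kind for both cells, both windows contain it and
    -- are equal, and it is interior to the evolved hole. Otherwise the second window's evolved hole
    -- removes it.
    · rcases Bool.eq_or_eq_not h.2.1 (k j) with hk' | hk'
      · have h1 := hpos (opp h) j hj (by rw [opp_snd_fst, hk'])
        rw [pos_opp] at h1
        obtain rfl := hS _ _ _ (hpos h i hi hk) h1
        obtain ⟨c, k', x⟩ := h
        dsimp only at hk
        subst hk
        exact ⟨i, (hL i).pos_mem_evolved_of_mem_mem c x hi hj, fun hc' => absurd hc' hc⟩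
      · have h1 := hopp (opp h) (by rwa [pos_opp]) (hrem (opp h) j hj (by rw [opp_snd_fst, hk']))
        rwa [opp_opp] at h1
    · exact hrem h i hi hk
  · rintro h ⟨i, hi⟩ hc
    exact (hmem h i hi fun h2 => hc ⟨i, h2⟩).imp (fun h1 => ⟨i, h1⟩) fun h1 => ⟨i, h1⟩

namespace Defect

/-- The squares of a hole. -/
def squares : Defect m n → Set (Square m n)
  | hole c k l => board c k l
  | _ => ∅

/-- The vertices at which a defect has a separation. -/
def cuts (D : Defect m n) : Set (Square m n) := D.verticalCuts ∪ D.horizontalCuts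

end Defect

lemma par_corner_snd (O : Window m n) : par (O.centre.1 + (O.width : ZMod (2 * n))) =
    par (O.centre.2 + (O.height : ZMod (2 * m))) + 1 := isVertex_iff.1 O.isVertex_corner

/-- The corners are white, so cell centres avoid the extreme columns but may lie in the extreme
rows. Left and right ends of inner cells thus stay in the window, while upper and lower ends may
stick out by one square, giving the board that is taller and narrower by one at each end. At width 0
there are no inner cells, so every vertex of the column is separated. -/
lemma Window.localEvolution_of_white (W : Set (Square m n)) (O : Window m n)
    (hO : O.WhitePlaced W) (hη : par (O.centre.1 + (O.width : ZMod (2 * n))) = η + 1) :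
    LocalEvolution η O.squares (O.evolve W).squares (O.evolve W).cuts true := by
  have hη' : par (O.centre.2 + (O.height : ZMod (2 * m))) = η :=
    add_right_cancel ((par_corner_snd O).symm.trans hη)
  have hne := zmod_two_add_one_ne η
  have hx : ∀ {c : Cell m n η} {l : ℕ}, par (O.centre.1 + (l : ZMod (2 * n))) = η + 1 →
      par c.1.1 ≠ par (O.centre.1 + (l : ZMod (2 * n))) := fun {c l} h => by rw [c.2.1, h]; exact hne.symm
  rcases Nat.eq_zero_or_pos O.width with hl | hl
  · have hE : (O.evolve W).squares = ∅ := by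
      simp [Window.evolve, hO, hl, Defect.squares]
    have hK : (O.evolve W).cuts = (Defect.verticalSeparations O.centre (O.height + 1) :
        Defect m n).verticalCuts := by
      simp [Window.evolve, hO, hl, Defect.cuts, Defect.horizontalCuts]
    have hS : ∀ c : Cell m n η, c.1 ∉ O.squares := by
      intro c hc
      have := (mem_board.1 hc).1.pred (hx hη)
      omega
    rw [hE, hK]
    refine ⟨fun c x h => absurd h (hS c), fun c x h => ?_, fun c x h => absurd h (hS c),
      fun c => ⟨fun h => absurd h (Set.notMem_empty _), fun h => absurd h (hS c)⟩,
      fun c x h => absurd h (Set.notMem_empty _), fun c x h => absurd h (Set.notMem_empty _),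
      fun c x h h' => ?_, ?_, fun c h => absurd h (hS c), fun c x h => absurd h (hS c)⟩
    · have := (mem_board.1 h).1.pred (hx hη)
      omega
    · exfalso
      refine h' ?_
      obtain ⟨⟨i, hi, h1⟩, ⟨j, hj, h2⟩⟩ := mem_board.1 h
      have hi0 : i = 0 := by omega
      have h3 : par (O.centre.2 + (j : ZMod (2 * m))) = par (O.centre.2 + (O.height : ZMod (2 * m))) := by
        rw [← h2, hη']; exact c.2.2
      rw [par_add_intCast] at h3
      -- The parity makes the offset equal to 2t - height with 0 ≤ t ≤ height, which numbers the
      -- height + 1 separations from the bottom.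
      obtain ⟨t, ht⟩ := h3
      lift t to ℕ using by omega
      refine ⟨t, by omega, Prod.ext (by rw [h1, hi0]; simp) ?_⟩
      rw [h2]
      have : j = 2 * (t : ℤ) - O.height := by omega
      rw [this]; push_cast; ring
    · rintro p ⟨t, ht, rfl⟩
      refine mem_board.2 ⟨⟨0, by simp, by simp⟩, 2 * (t : ℤ) - O.height, by omega, ?_⟩
      push_cast; ring
  · have hE : (O.evolve W).squares = board O.centre (O.height + 1) (O.width - 1) := by
      simp [Window.evolve, hO, Nat.one_le_iff_ne_zero.2 hl.ne', Defect.squares]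
    have hK : (O.evolve W).cuts = ∅ := by
      simp [Window.evolve, hO, Nat.one_le_iff_ne_zero.2 hl.ne', Defect.cuts,
        Defect.horizontalCuts, Defect.verticalCuts]
    obtain ⟨l, hl'⟩ : ∃ l, O.width = l + 1 := ⟨O.width - 1, by omega⟩
    have hηl : par (O.centre.1 + (l : ZMod (2 * n))) = η := by
      rw [hl'] at hη
      rw [par_add, par_natCast] at hη ⊢
      push_cast at hη
      rw [← add_assoc] at hη
      exact add_right_cancel hη
    have hS : O.squares = board O.centre O.height (l + 1) := by rw [← hl']; rfl
    rw [hE, hK, hS]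
    rw [hl'] at hη ⊢
    rw [Nat.add_sub_cancel]
    have hln : l + 1 < n := hl' ▸ O.width_lt
    refine ⟨?_, ?_, ?_, ?_, ?_, ?_, ?_, Set.empty_subset _, fun _ _ => rfl, ?_⟩ <;>
      simp only [mem_board, pos_true, pos_false, Bool.not_true, opp_true_fst, opp_false_fst]
    · exact fun c x h => ⟨(h.1.pred (hx hη)).2.add_sgn x, h.2⟩
    · intro c x h
      have h1 := h.2.pred (by rw [par_add, par_sgn, c.2.2, hη']; exact hne)
      exact ⟨h.1, h1.2.of_add_sgn.mono (by omega)⟩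
    · exact fun c x h => ⟨(h.1.pred (hx hη)).2, h.2.add_sgn x⟩
    · exact fun c => ⟨fun h => ⟨h.1.mono (by omega), h.2.of_succ (by rw [hη', c.2.2])⟩,
        fun h => ⟨(h.1.pred (hx hη)).2, h.2.mono (by omega)⟩⟩
    · exact fun c x h => ⟨h.1.of_add_sgn, h.2.of_succ (by rw [hη', c.2.2])⟩
    · exact fun c x h => (h.2.add_or_sub (by rw [hη', c.2.2])).imp
        (fun h2 => ⟨h.1.mono (by omega), h2⟩) (fun h2 => ⟨h.1.mono (by omega), h2⟩)
    · exact fun c x h _ => (h.1.add_or_sub (by rw [hηl, c.2.1])).imp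
        (fun h2 => ⟨h2.mono (by omega), h.2⟩) (fun h2 => ⟨h2.mono (by omega), h.2⟩)
    · exact fun c x h h' => ⟨h.1.mid h'.1 hln (hx hη), h.2.mono (by omega)⟩

/-- The white case with the two coordinates and the two colours exchanged; the degenerate case is
now height 0. -/
lemma Window.localEvolution_of_black (W : Set (Square m n)) (O : Window m n)
    (hO : ¬ O.WhitePlaced W) (hη' : par (O.centre.1 + (O.width : ZMod (2 * n))) = η) :
    LocalEvolution η O.squares (O.evolve W).squares (O.evolve W).cuts false := by
  have hη : par (O.centre.2 + (O.height : ZMod (2 * m))) = η + 1 := by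
    rw [← hη', par_corner_snd, zmod_two_add_one_add_one]
  have hne := zmod_two_add_one_ne η
  have hx : ∀ {c : Cell m n η} {k : ℕ}, par (O.centre.2 + (k : ZMod (2 * m))) = η + 1 →
      par c.1.2 ≠ par (O.centre.2 + (k : ZMod (2 * m))) := fun {c k} h => by
    rw [c.2.2, h]; exact hne.symm
  rcases Nat.eq_zero_or_pos O.height with hl | hl
  · have hE : (O.evolve W).squares = ∅ := by
      simp [Window.evolve, hO, hl, Defect.squares]
    have hK : (O.evolve W).cuts = (Defect.horizontalSeparations O.centre (O.width + 1) :
        Defect m n).horizontalCuts := by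
      simp [Window.evolve, hO, hl, Defect.cuts, Defect.verticalCuts]
    have hS : ∀ c : Cell m n η, c.1 ∉ O.squares := by
      intro c hc
      have := (mem_board.1 hc).2.pred (hx hη)
      omega
    rw [hE, hK]
    refine ⟨fun c x h => absurd h (hS c), fun c x h => ?_, fun c x h => absurd h (hS c),
      fun c => ⟨fun h => absurd h (Set.notMem_empty _), fun h => absurd h (hS c)⟩,
      fun c x h => absurd h (Set.notMem_empty _), fun c x h => absurd h (Set.notMem_empty _),
      fun c x h h' => ?_, ?_, fun c h => absurd h (hS c), fun c x h => absurd h (hS c)⟩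
    · have := (mem_board.1 h).2.pred (hx hη)
      omega
    · exfalso
      refine h' ?_
      obtain ⟨⟨j, hj, h2⟩, ⟨i, hi, h1⟩⟩ := mem_board.1 h
      have hi0 : i = 0 := by omega
      have h3 : par (O.centre.1 + (j : ZMod (2 * n))) =
          par (O.centre.1 + (O.width : ZMod (2 * n))) := by
        rw [← h2, hη']; exact c.2.1
      rw [par_add_intCast] at h3
      obtain ⟨t, ht⟩ := h3
      lift t to ℕ using by omega
      refine ⟨t, by omega, Prod.ext ?_ (by rw [h1, hi0]; simp)⟩
      rw [h2]
      have : j = 2 * (t : ℤ) - O.width := by omega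
      rw [this]; push_cast; ring
    · rintro p ⟨t, ht, rfl⟩
      refine mem_board.2 ⟨⟨2 * (t : ℤ) - O.width, by omega, ?_⟩, ⟨0, by simp, by simp⟩⟩
      push_cast; ring
  · have hE : (O.evolve W).squares = board O.centre (O.height - 1) (O.width + 1) := by
      simp [Window.evolve, hO, Nat.one_le_iff_ne_zero.2 hl.ne', Defect.squares]
    have hK : (O.evolve W).cuts = ∅ := by
      simp [Window.evolve, hO, Nat.one_le_iff_ne_zero.2 hl.ne', Defect.cuts,
        Defect.horizontalCuts, Defect.verticalCuts]
    obtain ⟨k, hk'⟩ : ∃ k, O.height = k + 1 := ⟨O.height - 1, by omega⟩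
    have hηk : par (O.centre.2 + (k : ZMod (2 * m))) = η := by
      rw [hk'] at hη
      rw [par_add, par_natCast] at hη ⊢
      push_cast at hη
      rw [← add_assoc] at hη
      exact add_right_cancel hη
    have hS : O.squares = board O.centre (k + 1) O.width := by rw [← hk']; rfl
    rw [hE, hK, hS]
    rw [hk'] at hη ⊢
    rw [Nat.add_sub_cancel]
    have hkm : k + 1 < m := hk' ▸ O.height_lt
    refine ⟨?_, ?_, ?_, ?_, ?_, ?_, ?_, Set.empty_subset _, fun _ _ => rfl, ?_⟩ <;>
      simp only [mem_board, pos_true, pos_false, Bool.not_false, opp_true_fst, opp_false_fst]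
    · exact fun c x h => ⟨h.1, (h.2.pred (hx hη)).2.add_sgn x⟩
    · intro c x h
      have h1 := h.1.pred (by rw [par_add, par_sgn, c.2.1, hη']; exact hne)
      exact ⟨h1.2.of_add_sgn.mono (by omega), h.2⟩
    · exact fun c x h => ⟨h.1.add_sgn x, (h.2.pred (hx hη)).2⟩
    · exact fun c => ⟨fun h => ⟨h.1.of_succ (by rw [hη', c.2.1]), h.2.mono (by omega)⟩,
        fun h => ⟨h.1.mono (by omega), (h.2.pred (hx hη)).2⟩⟩
    · exact fun c x h => ⟨h.1.of_succ (by rw [hη', c.2.1]), h.2.of_add_sgn⟩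
    · exact fun c x h => (h.1.add_or_sub (by rw [hη', c.2.1])).imp
        (fun h1 => ⟨h1, h.2.mono (by omega)⟩) (fun h1 => ⟨h1, h.2.mono (by omega)⟩)
    · exact fun c x h _ => (h.2.add_or_sub (by rw [hηk, c.2.2])).imp
        (fun h2 => ⟨h.1, h2.mono (by omega)⟩) (fun h2 => ⟨h.1, h2.mono (by omega)⟩)
    · exact fun c x h h' => ⟨h.1.mono (by omega), h.2.mid h'.2 hkm (hx hη)⟩

/-! ### Counting vertices and cells in windows -/

section NearCount

variable {N : ℕ} (c : ZMod (2 * N)) (l : ℕ)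

/-- The number of coordinates of parity `a` at distance at most `l` from `c`. -/
noncomputable def nearCount (a : ZMod 2) : ℕ := {x | Near c l x ∧ par x = a}.ncard

variable {c l}

/-- The offsets are 2t - l for 0 ≤ t ≤ l, and l < N keeps them distinct modulo 2N. -/
lemma nearCount_of_eq {a : ZMod 2} (hl : l < N) (ha : par (c + (l : ZMod (2 * N))) = a) :
    nearCount c l a = l + 1 := by
  subst ha
  have h : {x | Near c l x ∧ par x = par (c + (l : ZMod (2 * N)))} =
      (fun t : ℕ => c + ((2 * (t : ℤ) - l : ℤ) : ZMod (2 * N))) '' (Finset.range (l + 1)) := by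
    ext x
    simp only [Set.mem_ofPred_eq, Set.mem_image, Finset.coe_range, Set.mem_Iio]
    constructor
    · rintro ⟨⟨i, hi, rfl⟩, hp⟩
      rw [par_add_intCast] at hp
      obtain ⟨t, ht⟩ := hp
      lift t to ℕ using by omega
      exact ⟨t, by omega, by rw [show 2 * (t : ℤ) - l = i by omega]⟩
    · rintro ⟨t, ht, rfl⟩
      exact ⟨⟨_, by omega, rfl⟩, by rw [par_add_intCast]; exact ⟨t, by ring⟩⟩
  rw [nearCount, h, Set.InjOn.ncard_image, Set.ncard_coe_finset, card_range]
  intro t ht t' ht' h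
  simp only [Finset.coe_range, Set.mem_Iio] at ht ht'
  have h1 := add_left_cancel h
  rw [← sub_eq_zero, ← Int.cast_sub, ZMod.intCast_zmod_eq_zero_iff_dvd] at h1
  have h4 := Int.eq_zero_of_abs_lt_dvd h1 (abs_lt.2 (by push_cast; omega))
  omega

lemma nearCount_of_ne {a : ZMod 2} (hl : l < N) (ha : par (c + (l : ZMod (2 * N))) = a + 1) :
    nearCount c l a = l := by
  have hne : ∀ {x : ZMod (2 * N)}, par x = a → par x ≠ par (c + (l : ZMod (2 * N))) := by
    intro x h
    rw [h, ha]
    exact (zmod_two_add_one_ne a).symm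
  cases l with
  | zero =>
    have h : {x | Near c 0 x ∧ par x = a} = ∅ := by
      ext x
      simp only [Set.mem_ofPred_eq, Set.mem_empty_iff_false, iff_false]
      rintro ⟨h1, h2⟩
      have := (h1.pred (hne h2)).1
      omega
    rw [nearCount, h, Set.ncard_empty]
  | succ l =>
    have ha' : par (c + (l : ZMod (2 * N))) = a := by
      rw [Nat.cast_succ, ← add_assoc, par_add, par_one] at ha
      exact add_right_cancel ha
    refine Eq.trans (congrArg Set.ncard ?_) (nearCount_of_eq (l := l) (by omega) ha')
    ext x
    exact and_congr_left fun h => ⟨fun h1 => (h1.pred (hne h)).2, fun h1 => h1.mono (by omega)⟩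

end NearCount

lemma ncard_board (c : Square m n) (k l : ℕ) (a b : ZMod 2) :
    {p | p ∈ board c k l ∧ par p.1 = a ∧ par p.2 = b}.ncard =
      nearCount c.1 l a * nearCount c.2 k b := by
  rw [nearCount, nearCount, ← Set.ncard_prod]
  congr 1
  ext p
  simp only [Set.mem_ofPred_eq, Set.mem_prod, mem_board]
  tauto

/-- The white vertices of a proper colouring are those whose horizontal coordinate has a given
parity. -/
lemma IsProperColouring.exists_parity {W : Set (Square m n)} (hW : IsProperColouring W) :
    ∃ η : ZMod 2, ∀ p, IsVertex p → (p ∈ W ↔ par p.1 = η + 1) := by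
  have hv : ∀ i j : ℤ, Odd (i + j) → IsVertex (((i : ZMod (2 * n)), (j : ZMod (2 * m)))) := by
    intro i j h
    change par _ + par _ = 1
    rw [par_intCast, par_intCast, ← Int.cast_add]
    exact (ZMod.intCast_eq_one_iff_odd).2 h
  have hup : ∀ i j : ℤ, Odd (i + j) → (((i : ZMod (2 * n)), (j : ZMod (2 * m))) ∈ W ↔
      (((i + 1 : ℤ) : ZMod (2 * n)), ((j + 1 : ℤ) : ZMod (2 * m))) ∉ W) := fun i j h =>
    hW ((_, _), true) _ _ ⟨hv i j h, Or.inl ⟨rfl, by simp [diag, sgn]⟩⟩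
  have hdown : ∀ i j : ℤ, Odd (i + j) → (((i : ZMod (2 * n)), (j : ZMod (2 * m))) ∈ W ↔
      (((i + 1 : ℤ) : ZMod (2 * n)), ((j - 1 : ℤ) : ZMod (2 * m))) ∉ W) := fun i j h =>
    hW ((_, _), false) _ _ ⟨hv i j h, Or.inl ⟨rfl, by simp [diag, sgn, sub_eq_add_neg]⟩⟩
  -- Lifting the colouring to integer coordinates allows induction on translations. Two diagonal
  -- steps, hence two colour changes, give a translation by two along either axis, so only the
  -- parities matter.
  let f : ℤ → ℤ → Prop := fun i j => ((i : ZMod (2 * n)), (j : ZMod (2 * m))) ∈ W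
  have h2x : ∀ i j : ℤ, Odd (i + j) → (f i j ↔ f (i + 2) j) := by
    intro i j h
    have h1 := hup i j h
    have h2 := hdown (i + 1) (j + 1) (by convert h.add_even even_two using 1; ring)
    rw [show i + 1 + 1 = i + 2 by ring, add_sub_cancel_right] at h2
    simp only [f]
    tauto
  have h2y : ∀ i j : ℤ, Odd (i + j) → (f i j ↔ f i (j + 2)) := by
    intro i j h
    have h1 := hup i j h
    have h2 := hdown i (j + 2) (by convert h.add_even even_two using 1; ring)
    rw [show j + 2 - 1 = j + 1 by ring] at h2
    simp only [f]
    tauto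
  have hx : ∀ i j t : ℤ, Odd (i + j) → (f i j ↔ f (i + 2 * t) j) := by
    intro i j t h
    induction t using Int.induction_on with
    | zero => simp
    | succ t ih =>
      rw [ih, h2x _ _ (by convert h.add_even (even_two_mul (t : ℤ)) using 1; ring)]
      rw [show i + 2 * (t : ℤ) + 2 = i + 2 * (t + 1) by ring]
    | pred t ih =>
      rw [ih, show i + 2 * -(t : ℤ) = i + 2 * (-t - 1) + 2 by ring,
        ← h2x _ _ (by convert h.add_even (even_two_mul (-(t : ℤ) - 1)) using 1; ring)]
  have hy : ∀ i j t : ℤ, Odd (i + j) → (f i j ↔ f i (j + 2 * t)) := by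
    intro i j t h
    induction t using Int.induction_on with
    | zero => simp
    | succ t ih =>
      rw [ih, h2y _ _ (by convert h.add_even (even_two_mul (t : ℤ)) using 1; ring)]
      rw [show j + 2 * (t : ℤ) + 2 = j + 2 * (t + 1) by ring]
    | pred t ih =>
      rw [ih, show j + 2 * -(t : ℤ) = j + 2 * (-t - 1) + 2 by ring,
        ← h2y _ _ (by convert h.add_even (even_two_mul (-(t : ℤ) - 1)) using 1; ring)]
  -- The two translation classes of vertices are joined by an edge, so they get opposite colours.
  have h01 : f 0 1 ↔ ¬ f 1 0 := hdown 0 1 (by decide)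
  have hmain : ∀ p : Square m n, IsVertex p →
      (par p.1 = 0 ∧ (p ∈ W ↔ f 0 1)) ∨ (par p.1 = 1 ∧ (p ∈ W ↔ f 1 0)) := by
    rintro ⟨a, b⟩ hp
    obtain ⟨i, rfl⟩ := ZMod.intCast_surjective a
    obtain ⟨j, rfl⟩ := ZMod.intCast_surjective b
    have h : Odd (i + j) := by
      change par _ + par _ = 1 at hp
      rw [par_intCast, par_intCast, ← Int.cast_add] at hp
      exact (ZMod.intCast_eq_one_iff_odd).1 hp
    rcases Int.even_or_odd' i with ⟨s, rfl | rfl⟩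
    · obtain ⟨t, rfl⟩ : ∃ t, j = 1 + 2 * t := by
        obtain ⟨t, ht⟩ := h
        exact ⟨t - s, by omega⟩
      refine Or.inl ⟨?_, ?_⟩
      · rw [par_intCast]; exact (ZMod.intCast_eq_zero_iff_even).2 (even_two_mul s)
      · have h1 := hx 0 1 s (by decide)
        have h2 := hy (0 + 2 * s) 1 t (by convert (even_two_mul s).add_one using 1; ring)
        rw [zero_add] at h1 h2
        exact (h1.trans h2).symm
    · obtain ⟨t, rfl⟩ : ∃ t, j = 0 + 2 * t := by
        obtain ⟨t, ht⟩ := h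
        exact ⟨t - s, by omega⟩
      refine Or.inr ⟨?_, ?_⟩
      · rw [par_intCast]
        exact (ZMod.intCast_eq_one_iff_odd).2 (odd_two_mul_add_one s)
      · have h1 := hx 1 0 s (by decide)
        have h2 := hy (1 + 2 * s) 0 t (by convert (even_two_mul s).add_one using 1; ring)
        rw [add_comm 1 (2 * s)] at h1 h2
        exact (h1.trans h2).symm
  by_cases h : f 0 1
  · refine ⟨1, fun p hp => ?_⟩
    rcases hmain p hp with ⟨h1, h2⟩ | ⟨h1, h2⟩
    · rw [h1, h2]; exact iff_of_true h (by decide)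
    · rw [h1, h2]; exact iff_of_false (h01.1 h) (by decide)
  · refine ⟨0, fun p hp => ?_⟩
    rcases hmain p hp with ⟨h1, h2⟩ | ⟨h1, h2⟩
    · rw [h1, h2]; exact iff_of_false h (by decide)
    · rw [h1, h2]; exact iff_of_true (not_not.1 fun h' => h (h01.2 h')) (by decide)

namespace Window

variable {W : Set (Square m n)}

lemma vertices_inter_eq (hW : ∀ p, IsVertex p → (p ∈ W ↔ par p.1 = η + 1))
    (O : Window m n) :
    O.vertices ∩ W = {p | p ∈ O.squares ∧ par p.1 = η + 1 ∧ par p.2 = η} := by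
  ext p
  constructor
  · rintro ⟨⟨h1, h2⟩, h3⟩
    have h4 := (hW p h2).1 h3
    exact ⟨h1, h4, add_right_cancel ((isVertex_iff.1 h2).symm.trans h4)⟩
  · rintro ⟨h1, h2, h3⟩
    have h4 : IsVertex p := isVertex_iff.2 (by rw [h2, h3])
    exact ⟨⟨h1, h4⟩, (hW p h4).2 h2⟩

lemma vertices_diff_eq (hW : ∀ p, IsVertex p → (p ∈ W ↔ par p.1 = η + 1))
    (O : Window m n) :
    O.vertices \ W = {p | p ∈ O.squares ∧ par p.1 = η ∧ par p.2 = η + 1} := by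
  ext p
  constructor
  · rintro ⟨⟨h1, h2⟩, h3⟩
    rw [hW p h2, ← ne_eq, zmod_two_ne, zmod_two_add_one_add_one] at h3
    refine ⟨h1, h3, ?_⟩
    rw [← h3, isVertex_iff.1 h2, zmod_two_add_one_add_one]
  · rintro ⟨h1, h2, h3⟩
    have h4 : IsVertex p := isVertex_iff.2 (by rw [h2, h3, zmod_two_add_one_add_one])
    refine ⟨⟨h1, h4⟩, fun h5 => ?_⟩
    rw [hW p h4, h2] at h5
    exact zmod_two_add_one_ne η h5.symm

/-- The colour of the corners has (k+1)(l+1) vertices in the window and the other colour has kl. -/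
lemma whitePlaced_iff (hW : ∀ p, IsVertex p → (p ∈ W ↔ par p.1 = η + 1))
    (O : Window m n) :
    O.WhitePlaced W ↔ par (O.centre.1 + (O.width : ZMod (2 * n))) = η + 1 := by
  have hc := par_corner_snd O
  rw [WhitePlaced, vertices_inter_eq hW, vertices_diff_eq hW, squares, ncard_board, ncard_board]
  by_cases h : par (O.centre.1 + (O.width : ZMod (2 * n))) = η + 1
  · have h' : par (O.centre.2 + (O.height : ZMod (2 * m))) = η := add_right_cancel (hc.symm.trans h)
    rw [nearCount_of_eq O.width_lt h, nearCount_of_ne O.width_lt h,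
      nearCount_of_eq O.height_lt h', nearCount_of_ne O.height_lt (by rw [h', zmod_two_add_one_add_one])]
    exact iff_of_true (by nlinarith) h
  · have h0 : par (O.centre.1 + (O.width : ZMod (2 * n))) = η := by
      rw [← ne_eq, zmod_two_ne, zmod_two_add_one_add_one] at h; exact h
    have h' : par (O.centre.2 + (O.height : ZMod (2 * m))) = η + 1 := by
      rw [← h0, hc, zmod_two_add_one_add_one]
    rw [nearCount_of_eq O.width_lt h0,
      nearCount_of_ne O.width_lt (by rw [h0, zmod_two_add_one_add_one]),
      nearCount_of_eq O.height_lt h', nearCount_of_ne O.height_lt h']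
    exact iff_of_false (by nlinarith) h

/-- Cells minus black vertices: (k+1)l - kl = l with white corners, and k(l+1) - (k+1)(l+1) = -(l+1)
with black ones. -/
lemma flankCharge_eq (hW : ∀ p, IsVertex p → (p ∈ W ↔ par p.1 = η + 1))
    (O : Window m n) :
    O.flankCharge W = ({p | p ∈ O.squares ∧ par p.1 = η ∧ par p.2 = η}.ncard : ℤ) -
      (O.vertices \ W).ncard := by
  have hc := par_corner_snd O
  rw [flankCharge, vertices_diff_eq hW, squares, ncard_board, ncard_board]
  simp only [whitePlaced_iff hW]
  by_cases h : par (O.centre.1 + (O.width : ZMod (2 * n))) = η + 1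
  · have h' : par (O.centre.2 + (O.height : ZMod (2 * m))) = η := add_right_cancel (hc.symm.trans h)
    rw [nearCount_of_ne O.width_lt h, nearCount_of_eq O.height_lt h',
      nearCount_of_ne O.height_lt (by rw [h', zmod_two_add_one_add_one]), if_pos h]
    push_cast; ring
  · have h0 : par (O.centre.1 + (O.width : ZMod (2 * n))) = η := by
      rw [← ne_eq, zmod_two_ne, zmod_two_add_one_add_one] at h; exact h
    have h' : par (O.centre.2 + (O.height : ZMod (2 * m))) = η + 1 := by
      rw [← h0, hc, zmod_two_add_one_add_one]
    rw [nearCount_of_eq O.width_lt h0, nearCount_of_eq O.height_lt h',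
      nearCount_of_ne O.height_lt h', if_neg h]
    push_cast; ring

end Window

/-- In an admissible state of the torus with deleted vertices, every remaining vertex of the second
colour class is covered once. -/
lemma sum_cellCount [NeZero m] [NeZero n] {H : Set (Square m n)} {s : Cell m n η → Bool → Bool → Bool}
    (hs : ValidState opp {h | pos h ∈ H} ∅ s) :
    ∑ c, cellCount (s c) = {p | IsVertex p ∧ par p.1 = η ∧ p ∉ H}.ncard := by
  have h1 : ∑ c, cellCount (s c) =
      (univ.filter fun q : Cell m n η × Bool => s q.1 false q.2 = true).card := by
    rw [card_filter, Fintype.sum_prod_type]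
    refine sum_congr rfl fun c _ => ?_
    rw [Fintype.sum_bool, cellCount]
    cases s c false false <;> cases s c false true <;> rfl
  have h2 : {p | IsVertex p ∧ par p.1 = η ∧ p ∉ H} =
      (fun q : Cell m n η × Bool => pos (q.1, false, q.2)) ''
        (univ.filter fun q : Cell m n η × Bool => s q.1 false q.2 = true) := by
    ext p
    simp only [Set.mem_ofPred_eq, Set.mem_image, coe_filter, mem_univ, true_and]
    constructor
    · rintro ⟨hp, hpar, hpH⟩
      obtain ⟨⟨c, k, x⟩, rfl, -⟩ := exists_half (η := η) hp (true, true)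
      cases k
      · by_cases hc : s c false x = true
        · exact ⟨(c, x), hc, rfl⟩
        · have h3 := ((hs (c, false, x)).2 hpH).2 (Set.notMem_empty _)
          rw [Bool.not_eq_true] at hc
          dsimp only at h3
          rw [hc] at h3
          refine ⟨((opp (c, false, x)).1, (opp (c, false, x)).2.2), ?_,
            pos_opp (c, false, x)⟩
          have h4 : s (opp (c, false, x)).1 (opp (c, false, x)).2.1 (opp (c, false, x)).2.2 =
              true := by simpa using h3.symm
          exact h4
      · rw [par_pos_true] at hpar
        exact absurd hpar (zmod_two_add_one_ne η)
    · rintro ⟨⟨c, x⟩, hc, rfl⟩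
      refine ⟨isVertex_pos _, par_pos_false c x, fun hH => ?_⟩
      have := (hs (c, false, x)).1 hH
      dsimp only at this hc
      rw [this] at hc
      exact absurd hc (by decide)
  rw [h1, h2, Set.InjOn.ncard_image, Set.ncard_coe_finset]
  rintro ⟨c, x⟩ hc ⟨c', x'⟩ hc' h
  simp only [coe_filter, mem_univ, true_and, Set.mem_ofPred_eq] at hc hc'
  rcases (pos_eq_iff _ _).1 h with h3 | h3
  · simpa using h3
  · exfalso
    have hH : (c, false, x) ∉ {h : Half m n η | pos h ∈ H} := fun hH => by
      have := (hs (c, false, x)).1 hH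
      dsimp only at this
      rw [this] at hc
      exact absurd hc (by decide)
    have h4 := ((hs (c, false, x)).2 hH).2 (Set.notMem_empty _)
    have h5 : opp (c, false, x) = (c', false, x') := by rw [h3, opp_opp]
    rw [h5] at h4
    dsimp only at h4
    rw [hc, hc'] at h4
    exact absurd h4 (by decide)

/-- Every black vertex is the upper end of exactly one cell. -/
lemma card_cell [NeZero m] [NeZero n] :
    Fintype.card (Cell m n η) = {p : Square m n | IsVertex p ∧ par p.1 = η}.ncard := by
  have h : {p : Square m n | IsVertex p ∧ par p.1 = η} =
      Set.range fun c : Cell m n η => pos (c, false, true) := by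
    ext p
    constructor
    · rintro ⟨hp, hpar⟩
      refine ⟨⟨(p.1, p.2 - 1), hpar, ?_⟩, by simp [pos_false, sgn_true]⟩
      rw [par_sub, par_one, ← hpar, isVertex_iff.1 hp]
      generalize par p.2 = b
      revert b; decide
    · rintro ⟨c, rfl⟩
      exact ⟨isVertex_pos _, par_pos_false _ _⟩
  rw [h, ← Set.image_univ, Set.InjOn.ncard_image, Set.ncard_univ, Nat.card_eq_fintype_card]
  intro c _ c' _ h
  simp only [pos_false, Prod.mk.injEq, add_left_inj] at h
  exact Subtype.ext (Prod.ext h.1 h.2)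

/-- The square next to a vertex on the side of a copy is the centre of the cell that uses this copy,
so the rule for touching defects becomes a condition on that cell. -/
lemma mem_removed_iff {D : Defect m n} {CV CH : Set (Square m n)}
    (hV : ∀ p ∈ CV, par p.1 = η + 1) (hH : ∀ p ∈ CH, par p.1 = η) (h : Half m n η) :
    attach (copyAt CV CH) h ∈ D.removed ↔
      pos h ∈ D.squares ∧ (pos h ∈ CV ∪ CH → h.1.1 ∈ D.squares) := by
  classical
  cases D with
  | verticalSeparations c s => exact ⟨fun h => absurd h (Set.notMem_empty _), fun h => h.1⟩
  | horizontalSeparations c s => exact ⟨fun h => absurd h (Set.notMem_empty _), fun h => h.1⟩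
  | hole c k l =>
    have h0 : attach (copyAt CV CH) h ∈ (Defect.hole c k l).removed ↔ pos h ∈ board c k l ∧
        (pos h ∈ CV → ((pos h).1 + sgn (!h.2.2), (pos h).2) ∈ board c k l) ∧
        (pos h ∈ CH → ((pos h).1, (pos h).2 + sgn (!h.2.2)) ∈ board c k l) := by
      have h1 : ∀ (p : Square m n) (b : Bool), IsVertex p → ((p ∈ oddAztec c k l ∧
          (∀ b', (if p ∈ CV then some b else none) = some b' → (p.1 + sgn b', p.2) ∈ board c k l) ∧
          (∀ b', (if p ∈ CH then some b else none) = some b' →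
            (p.1, p.2 + sgn b') ∈ board c k l)) ↔ (p ∈ board c k l ∧
          (p ∈ CV → (p.1 + sgn b, p.2) ∈ board c k l) ∧
          (p ∈ CH → (p.1, p.2 + sgn b) ∈ board c k l))) := by
        intro p b hp
        refine and_congr (and_iff_left hp) (and_congr ?_ ?_)
        · by_cases h1 : p ∈ CV <;> cases b <;> simp [h1]
        · by_cases h1 : p ∈ CH <;> cases b <;> simp [h1]
      exact h1 _ _ (isVertex_pos h)
    rw [h0]
    obtain ⟨c', k', x⟩ := h
    cases k'
    · have h1 : pos (c', false, x) ∉ CV := fun h1 =>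
        zmod_two_add_one_ne η ((hV _ h1).symm.trans (par_pos_false c' x))
      rw [pos_false] at h1
      simp [Defect.squares, h1, pos_false, sgn_not]
    · have h1 : pos (c', true, x) ∉ CH := fun h1 =>
        zmod_two_add_one_ne η ((par_pos_true c' x).symm.trans (hH _ h1))
      rw [pos_true] at h1
      simp [Defect.squares, h1, pos_true, sgn_not]

/-! ### Local evolution of windows and the exponent of 2. -/

section Main

variable {W : Set (Square m n)}

lemma Window.localEvolution (hW : ∀ p, IsVertex p → (p ∈ W ↔ par p.1 = η + 1)) (O : Window m n) :
    ∃ k, LocalEvolution η O.squares (O.evolve W).squares (O.evolve W).cuts k := by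
  by_cases h : O.WhitePlaced W
  · exact ⟨true, O.localEvolution_of_white W h ((whitePlaced_iff hW O).1 h)⟩
  · refine ⟨false, O.localEvolution_of_black W h ?_⟩
    rw [whitePlaced_iff hW, ← ne_eq, zmod_two_ne, zmod_two_add_one_add_one] at h
    exact h

lemma Window.par_of_mem_verticalCuts (hW : ∀ p, IsVertex p → (p ∈ W ↔ par p.1 = η + 1))
    (O : Window m n) {p : Square m n} (hp : p ∈ (O.evolve W).verticalCuts) :
    par p.1 = η + 1 := by
  unfold Window.evolve at hp
  split_ifs at hp with h1 h2 h2
  · exact absurd hp (Set.notMem_empty _)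
  · obtain ⟨i, -, rfl⟩ := hp
    have h3 := (whitePlaced_iff hW O).1 h1
    simpa [show O.width = 0 by omega] using h3
  · exact absurd hp (Set.notMem_empty _)
  · exact absurd hp (Set.notMem_empty _)

lemma Window.par_of_mem_horizontalCuts (hW : ∀ p, IsVertex p → (p ∈ W ↔ par p.1 = η + 1))
    (O : Window m n) {p : Square m n} (hp : p ∈ (O.evolve W).horizontalCuts) :
    par p.1 = η := by
  unfold Window.evolve at hp
  split_ifs at hp with h1 h2 h2
  · exact absurd hp (Set.notMem_empty _)
  · exact absurd hp (Set.notMem_empty _)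
  · exact absurd hp (Set.notMem_empty _)
  · obtain ⟨i, -, rfl⟩ := hp
    rw [whitePlaced_iff hW, ← ne_eq, zmod_two_ne, zmod_two_add_one_add_one] at h1
    rw [← h1]
    have h3 : (2 * (i : ZMod (2 * n)) - (((O.width + 1 : ℕ) : ZMod (2 * n)) - 1)) =
        ((2 * (i : ℤ) - O.width : ℤ) : ZMod (2 * n)) := by push_cast; ring
    rw [h3, par_add_intCast]
    exact ⟨i, by ring⟩

/-- The number of cells in the windows minus the number of deleted vertices of the second colour
class is the total flank charge. -/
lemma sum_flankCharge [NeZero m] [NeZero n]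
    (hW : ∀ p, IsVertex p → (p ∈ W ↔ par p.1 = η + 1)) {r : ℕ} (O : Fin r → Window m n)
    (hdisj : ∀ i j, i ≠ j → Disjoint (O i).squares (O j).squares) :
    ({p | IsVertex p ∧ par p.1 = η ∧ p ∉ ⋃ i, (O i).vertices}.ncard : ℤ) -
        Fintype.card (Cell m n η) + {c : Cell m n η | ∃ i, c.1 ∈ (O i).squares}.ncard =
      ∑ i, (O i).flankCharge W := by
  have h1 : {c : Cell m n η | ∃ i, c.1 ∈ (O i).squares}.ncard =
      ∑ i, {p | p ∈ (O i).squares ∧ par p.1 = η ∧ par p.2 = η}.ncard := by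
    rw [← Set.ncard_image_of_injective _ Subtype.val_injective, ← finsum_eq_sum_of_fintype,
      ← Set.ncard_iUnion_of_finite (fun i => Set.toFinite _)]
    · congr 1
      ext p
      simp only [Set.mem_image, Set.mem_ofPred_eq, Set.mem_iUnion]
      constructor
      · rintro ⟨c, ⟨i, hi⟩, rfl⟩
        exact ⟨i, hi, c.2⟩
      · rintro ⟨i, hi, hp⟩
        exact ⟨⟨p, hp⟩, ⟨i, hi⟩, rfl⟩
    · exact fun i j hij => (hdisj i j hij).mono (fun p hp => hp.1) (fun p hp => hp.1)
  have h2 : Fintype.card (Cell m n η) =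
      {p | IsVertex p ∧ par p.1 = η ∧ p ∉ ⋃ i, (O i).vertices}.ncard +
        ∑ i, ((O i).vertices \ W).ncard := by
    -- The cells are counted as black vertices, which are either remaining or deleted by exactly one
    -- window.
    rw [card_cell, ← finsum_eq_sum_of_fintype,
      ← Set.ncard_iUnion_of_finite (fun i => Set.toFinite ((O i).vertices \ W)),
      ← Set.ncard_union_eq]
    · congr 1
      ext p
      simp only [Set.mem_ofPred_eq, Set.mem_union, Set.mem_iUnion, Set.mem_sdiff]
      constructor
      · rintro ⟨hp, hpar⟩
        by_cases h : ∃ i, p ∈ (O i).vertices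
        · obtain ⟨i, hi⟩ := h
          refine Or.inr ⟨i, hi, fun h3 => ?_⟩
          rw [hW p hp, hpar] at h3
          exact zmod_two_add_one_ne η h3.symm
        · exact Or.inl ⟨hp, hpar, h⟩
      · rintro (⟨hp, hpar, -⟩ | ⟨i, hi, h3⟩)
        · exact ⟨hp, hpar⟩
        · rw [hW p hi.2, ← ne_eq, zmod_two_ne, zmod_two_add_one_add_one] at h3
          exact ⟨hi.2, h3⟩
    · rw [Set.disjoint_left]
      rintro p ⟨-, -, hp⟩ hp'
      obtain ⟨i, hi⟩ := Set.mem_iUnion.1 hp'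
      exact hp (Set.mem_iUnion.2 ⟨i, hi.1⟩)
    · exact fun i j hij => (hdisj i j hij).mono (fun p hp => hp.1.1) (fun p hp => hp.1.1)
  rw [h1, h2]
  simp only [Window.flankCharge_eq hW, sum_sub_distrib]
  push_cast
  ring

end Main

end ToroidalAztec

/-! ### The evolution theorem. -/

theorem theorem4p2 (m n : ℕ) (hm : 1 ≤ m) (hn : 1 ≤ n)
    (W : Set (ToroidalAztec.Square m n)) (hW : ToroidalAztec.IsProperColouring W)
    (r : ℕ) (O : Fin r → ToroidalAztec.Window m n)
    (hdisj : ∀ i j, i ≠ j → Disjoint (O i).squares (O j).squares)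
    (hcharge : ∑ i, (O i).charge W = 0)
    (hmatch : ∃ M, ToroidalAztec.IsPerfectMatching (ToroidalAztec.torusWithWindows O) M) :
    (ToroidalAztec.numPerfectMatchings (ToroidalAztec.torusWithWindows O) : ℚ) =
      (2 : ℚ) ^ (∑ i, (O i).flankCharge W) *
        (ToroidalAztec.numPerfectMatchings
          (ToroidalAztec.torusWithDefects fun i => (O i).evolve W) : ℚ) := by
  classical
  have : NeZero m := ⟨by omega⟩
  have : NeZero n := ⟨by omega⟩
  obtain ⟨M, hM⟩ := hmatch
  obtain ⟨η, hη⟩ := hW.exists_parity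
  have hpos : ToroidalAztec.numPerfectMatchings (ToroidalAztec.torusWithWindows O) ≠ 0 :=
    Set.ncard_ne_zero_of_mem hM (Set.toFinite _)
  choose k hk using fun i => ToroidalAztec.Window.localEvolution hη (O i)
  have hcompl := ToroidalAztec.LocalEvolution.complementaryDefects hk fun i j p hi hj => by
    by_contra hij
    exact Set.disjoint_left.1 (hdisj i j hij) hi hj
  have hV : ∀ p ∈ ⋃ i, ((O i).evolve W).verticalCuts, ToroidalAztec.par p.1 = η + 1 := by
    intro p hp
    obtain ⟨i, hi⟩ := Set.mem_iUnion.1 hp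
    exact (O i).par_of_mem_verticalCuts hη hi
  have hH : ∀ p ∈ ⋃ i, ((O i).evolve W).horizontalCuts, ToroidalAztec.par p.1 = η := by
    intro p hp
    obtain ⟨i, hi⟩ := Set.mem_iUnion.1 hp
    exact (O i).par_of_mem_horizontalCuts hη hi
  have hgW := ToroidalAztec.isGluing_torusWithWindows (η := η) O
  have hgD := ToroidalAztec.isGluing_torusWithDefects (η := η) (fun i => (O i).evolve W) hV hH
  have hdel : {h : ToroidalAztec.Half m n η | ∃ i, ToroidalAztec.pos h ∈ (O i).squares} =
      {h | ToroidalAztec.pos h ∈ ⋃ i, (O i).vertices} := by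
    ext h
    simp only [Set.mem_ofPred_eq, Set.mem_iUnion]
    exact exists_congr fun i => ⟨fun h1 => ⟨h1, ToroidalAztec.isVertex_pos h⟩, fun h1 => h1.1⟩
  have hcuts : ∀ p, (p ∈ (⋃ i, ((O i).evolve W).verticalCuts) ∪
      ⋃ i, ((O i).evolve W).horizontalCuts) ↔ ∃ j, p ∈ ((O j).evolve W).cuts := by
    intro p
    simp only [ToroidalAztec.Defect.cuts, Set.mem_union, Set.mem_iUnion, exists_or]
  rw [hdel] at hcompl
  have hsW : ∀ s, ToroidalAztec.Admissible ToroidalAztec.pos (⋃ i, (O i).vertices) s ↔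
      ToroidalAztec.ValidState (ToroidalAztec.opp (η := η))
        {h | ToroidalAztec.pos h ∈ ⋃ i, (O i).vertices} ∅ s :=
    ToroidalAztec.admissible_iff_validState ToroidalAztec.opp_ne fun h h' => by
      rw [ToroidalAztec.pos_eq_iff]; simp
  have hsD := ToroidalAztec.admissible_iff_validState (R := ⋃ i, ((O i).evolve W).removed)
    (ToroidalAztec.opp_ne (η := η))
    (ToroidalAztec.attach_copyAt_eq_iff (CV := ⋃ i, ((O i).evolve W).verticalCuts)
      (CH := ⋃ i, ((O i).evolve W).horizontalCuts))
  have hrem : (ToroidalAztec.attach (η := η)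
      (ToroidalAztec.copyAt (⋃ i, ((O i).evolve W).verticalCuts)
        (⋃ i, ((O i).evolve W).horizontalCuts))) ⁻¹' (⋃ i, ((O i).evolve W).removed) =
      {h | ∃ i, ToroidalAztec.pos h ∈ ((O i).evolve W).squares ∧
        ((∃ j, ToroidalAztec.pos h ∈ ((O j).evolve W).cuts) →
          h.1.1 ∈ ((O i).evolve W).squares)} := by
    ext h
    simp only [Set.mem_preimage, Set.mem_iUnion, Set.mem_ofPred_eq,
      ToroidalAztec.mem_removed_iff hV hH, hcuts]
  have hcut : {h : ToroidalAztec.Half m n η | ToroidalAztec.pos h ∈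
      (⋃ i, ((O i).evolve W).verticalCuts) ∪ ⋃ i, ((O i).evolve W).horizontalCuts} =
      {h | ∃ j, ToroidalAztec.pos h ∈ ((O j).evolve W).cuts} := by
    ext h
    exact hcuts _
  rw [hrem, hcut] at hsD
  rw [hgW.numPerfectMatchings_eq] at hpos ⊢
  rw [hgD.numPerfectMatchings_eq]
  simp only [hsW] at hpos ⊢
  simp only [hsD]
  -- Complementation yields the exponent in terms of remaining black vertices, all cells and empty
  -- cells; `sum_flankCharge` identifies it with the total flank charge.
  rw [hcompl.sum_prod_cellWeight (fun s hs => ToroidalAztec.sum_cellCount hs) hpos,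
    ← ToroidalAztec.sum_flankCharge hη O hdisj]
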